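/- There is an absolute constant $c>0$ such that the following holds. **Setting.** Let $X=(X_j)_{j=0,\dots,J}$ be a Markov process with values in a measurable space $\mathcal X$, adapted to a filtration $(\mathcal F_j)_{j=0,\dots,J}$; let $X^{j,x}$ be the process conditioned on $X_j=x$ and $\mu_j$ the law of $X_j$. Let $\mathcal K$ (actions) and $\mathcal L$ (controls) be finite sets. For $0\le j\le J$ let $K_j(y,x)\subset\mathcal K$ be nonempty sets of admissible actions ($y\in\mathcal L$, $x\in\mathcal X$) and $H_j(a,y,x)$ real cash-flows, both measurable in $x$, and let $\varphi_{j+1}:\mathcal K\times\mathcal L\to\mathcal L$ be control updates. Assume $|H_j(a,y,x)|\le C_H$ for all $j\le J$ and all $a,y,x$, put $W=JC_H$, and assume $W\ge1$. For an adapted $\mathcal K$-valued process $\mathbf A=(A_\ell)_{\ell=j}^J$ put $Y_j=y$, $Y_{\ell+1}=\varphi_{\ell+1}(A_\ell,Y_\ell)$; $\mathbf A$ is admissible for $(j,y,x)$ if almost surely $A_\ell\in K_\ell(Y_\ell,X^{j,x}_\ell)$ for $\ell=j,\dots,J$. Let $$v^*_j(y,x)=\sup_{\mathbf A\text{ admissible}}\mathsf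 E\Big[\sum_{\ell=j}^J H_\ell(A_\ell,Y_\ell,X^{j,x}_\ell)\Big],\qquad C^*_j(z,x)=\mathsf E\big[v^*_{j+1}(z,X^{j,x}_{j+1})\big]\quad(j<J).$$ **Estimates.** Let $M\ge1$. For $j=0,\dots,J-1$ let $\mathcal D_{M,j}=\{(X_j^{(m)},X_{j+1}^{(m)}):m=1,\dots,M\}$ be i.i.d. pairs with the law of $(X_j,X_{j+1})$, the sets $\mathcal D_{M,j}$ being independent for different $j$; let $\mathbb P_M$ be the law of the whole sample and $\mathcal G_{j,M}$ the $\sigma$-algebra generated by $\mathcal D_{M,j},\dots,\mathcal D_{M,J-1}$. Let $\Psi_j$ be fixed, not necessarily linear, classes of measurable functions $\mathcal X\to\mathbb R$, and let $T_W$ be truncation of values to $[-W,W]$. Put $v_{J,M}(y,x)=\sup_{a\in K_J(y,x)}H_J(a,y,x)$ and, for $j=J-1,\dots,0$, $$v_{j,M}(y,x)=\sup_{a\in K_j(y,x)}\big(H_j(a,y,x)+\widehat C_j(\varphi_{j+1}(a,y),x)\big),\qquad \widehat C_j(z,x)=T_W\mathcal P_j(z,x),$$ where, for every $z\in\mathcal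 L$, $\mathcal P_j(z,\cdot)\in\Psi_j$ minimises $\psi\mapsto\sum_{m=1}^M|v_{j+1,M}(z,X^{(m)}_{j+1})-\psi(X_j^{(m)})|^2$ over $\Psi_j$ and $\mathcal P_j(z,x)$ is jointly measurable in $x$ and the sample, with respect to $\mathcal G_{j,M}$ in the latter. Let $\widetilde C_j(z,x)$ be the expectation of $v_{j+1,M}(z,X^{j,x}_{j+1})$ for a trajectory independent of the sample, with the sample kept fixed. **Claim.** Let $$\mathcal E_j=\Big\|\sup_{z\in\mathcal L}\big|\widehat C_j(z,\cdot)-C^*_j(z,\cdot)\big|\Big\|_{L_2(\mu_j\otimes\mathbb P_M)}\ (0\le j\le J-1),\quad \mathcal E_J=0,\quad \varepsilon_{j,M}^2=c\,W^4\,\frac{1+\log M}{M}\,\mathrm{VC}(\Psi_j),$$ where $\mathrm{VC}(\Psi_j)\in\{0,1,\dots,\infty\}$ is the Vapnik–Chervonenkis dimension of the class of subgraphs $\{(x,t):t\le f(x)\}$, $f\in\Psi_j$. Then for all $j=0,\dots,J-1$ $$\mathcal E_j\le|\mathcal L|\Big(\varepsilon_{j,M}+\sqrt2\,\sup_{z\in\mathcal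 L}\inf_{w\in\Psi_j}\big\|\widetilde C_j(z,\cdot)-w\big\|_{L_2(\mu_j\otimes\mathbb P_M)}\Big)+|\mathcal L|\,\mathcal E_{j+1}.$$ -/

import Mathlib

open MeasureTheory

namespace RegressionControl

/-- A discrete-time Markov process `X` with values in `𝒳`, with time horizon `J`, on a measurable
space `Ω` and relative to a filtration `ℱ`. The measure `P` is the reference law of the process;
`Pc j x` is the law of the process conditioned on `X_j = x`, so that `X^{j,x}` is `X` under
`Pc j x`. Only the times `0, …, J` matter. -/
structure MarkovModel (Ω 𝒳 : Type*) [mΩ : MeasurableSpace Ω] [MeasurableSpace 𝒳] where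
  /-- time horizon -/
  J : ℕ
  /-- filtration -/
  ℱ : Filtration ℕ mΩ
  /-- the process -/
  X : ℕ → Ω → 𝒳
  /-- reference law -/
  P : Measure Ω
  /-- law given `X_j = x` -/
  Pc : ℕ → 𝒳 → Measure Ω
  adapted : ∀ j ≤ J, Measurable[ℱ j] (X j)
  prob : IsProbabilityMeasure P
  prob_cond : ∀ j ≤ J, ∀ x, IsProbabilityMeasure (Pc j x)
  start : ∀ j ≤ J, ∀ x, (Pc j x).map (X j) = Measure.dirac x
  measurable_transition : ∀ j < J, ∀ B : Set 𝒳, MeasurableSet B →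
    Measurable fun x => Pc j x (X (j + 1) ⁻¹' B)
  /-- Markov property under `P`: given `ℱ_l`, the law of `X_{l+1}` is that of `X^{l,x}_{l+1}`
  at `x = X_l`. -/
  markov : ∀ l < J, ∀ A : Set Ω, MeasurableSet[ℱ l] A → ∀ B : Set 𝒳, MeasurableSet B →
    P (A ∩ X (l + 1) ⁻¹' B) = ∫⁻ ω in A, Pc l (X l ω) (X (l + 1) ⁻¹' B) ∂P
  /-- Markov property of the conditioned process. -/
  markov_cond : ∀ j x l, j ≤ l → l < J → ∀ A : Set Ω, MeasurableSet[ℱ l] A →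
    ∀ B : Set 𝒳, MeasurableSet B →
    Pc j x (A ∩ X (l + 1) ⁻¹' B) = ∫⁻ ω in A, Pc l (X l ω) (X (l + 1) ⁻¹' B) ∂(Pc j x)

/-- The data of the control problem: cash-flows `H_j(a, y, x)`, admissible action sets
`K_j(y, x)` and control updates `φ_{j+1}(a, y)`. -/
structure ControlData (𝒳 𝓚 𝓛 : Type*) [MeasurableSpace 𝒳] where
  H : ℕ → 𝓚 → 𝓛 → 𝒳 → ℝ
  K : ℕ → 𝓛 → 𝒳 → Set 𝓚
  φ : ℕ → 𝓚 → 𝓛 → 𝓛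
  measurable_H : ∀ j a y, Measurable (H j a y)
  measurable_K : ∀ j y a, MeasurableSet {x | a ∈ K j y x}
  nonempty_K : ∀ j y x, (K j y x).Nonempty

section Control

variable {Ω 𝒳 𝓚 𝓛 : Type*} [MeasurableSpace Ω] [MeasurableSpace 𝒳]

/-- `controlAfter φ a j y n` is the control `Y_{j+n}(a; j, y)` reached from `Y_j = y` under the
actions `a_j, a_{j+1}, …`. -/
def controlAfter (φ : ℕ → 𝓚 → 𝓛 → 𝓛) (a : ℕ → 𝓚) (j : ℕ) (y : 𝓛) : ℕ → 𝓛
  | 0 => y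
  | n + 1 => φ (j + n + 1) (a (j + n)) (controlAfter φ a j y n)

/-- The control `Y_l(a; j, y)` at time `l ≥ j`. -/
def control (φ : ℕ → 𝓚 → 𝓛 → 𝓛) (a : ℕ → 𝓚) (j : ℕ) (y : 𝓛) (l : ℕ) : 𝓛 :=
  controlAfter φ a j y (l - j)

/-- The admissible policies `𝒜_j(y, x)`: processes `(A_l)_{j ≤ l ≤ J}` adapted to the filtration
(the action set carries the discrete σ-algebra) such that, almost surely for the process started
at `X_j = x`, each `A_l` lies in `K_l(Y_l(A; j, y), X_l)`. -/
def IsAdmissible (m : MarkovModel Ω 𝒳) (d : ControlData 𝒳 𝓚 𝓛) (j : ℕ) (y : 𝓛) (x : 𝒳)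
    (A : ℕ → Ω → 𝓚) : Prop :=
  (∀ l ∈ Finset.Icc j m.J, @Measurable Ω 𝓚 (m.ℱ l) ⊤ (A l)) ∧
  ∀ᵐ ω ∂(m.Pc j x), ∀ l ∈ Finset.Icc j m.J,
    A l ω ∈ d.K l (control d.φ (fun i => A i ω) j y l) (m.X l ω)

/-- The value function `v*_j(y, x)`: the supremum over the admissible policies of the expected
total cash-flow. -/
noncomputable def valueFunction (m : MarkovModel Ω 𝒳) (d : ControlData 𝒳 𝓚 𝓛) (j : ℕ) (y : 𝓛)
    (x : 𝒳) : ℝ :=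
  ⨆ A : {A : ℕ → Ω → 𝓚 // IsAdmissible m d j y x A},
    ∫ ω, ∑ l ∈ Finset.Icc j m.J,
      d.H l (A.1 l ω) (control d.φ (fun i => A.1 i ω) j y l) (m.X l ω) ∂(m.Pc j x)

/-- The continuation function `C*_j(z, x) = E[v*_{j+1}(z, X^{j,x}_{j+1})]`. -/
noncomputable def contFunction (m : MarkovModel Ω 𝒳) (d : ControlData 𝒳 𝓚 𝓛) (j : ℕ) (z : 𝓛)
    (x : 𝒳) : ℝ :=
  ∫ ω, valueFunction m d (j + 1) z (m.X (j + 1) ω) ∂(m.Pc j x)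

end Control

section VC

variable {α 𝒳 : Type*}

/-- A finite set of points is shattered by a class of sets if each of its subsets is the trace of
a set of the class. -/
def IsShattered (𝒜 : Set (Set α)) (S : Finset α) : Prop :=
  ∀ T ⊆ S, ∃ A ∈ 𝒜, ∀ p ∈ S, p ∈ A ↔ p ∈ T

/-- The Vapnik–Chervonenkis dimension of a class of sets (possibly infinite). -/
noncomputable def vcDimSets (𝒜 : Set (Set α)) : ℕ∞ :=
  ⨆ (S : Finset α) (_ : IsShattered 𝒜 S), (S.card : ℕ∞)

/-- The Vapnik–Chervonenkis dimension of a class of functions: that of the class of its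
subgraphs `{(x, t) | t ≤ f x}`. -/
noncomputable def vcDim (Ψ : Set (𝒳 → ℝ)) : ℕ∞ :=
  vcDimSets ((fun f : 𝒳 → ℝ => {p : 𝒳 × ℝ | p.2 ≤ f p.1}) '' Ψ)

end VC

section Regression

variable {Ω 𝒳 𝓚 𝓛 : Type*} [MeasurableSpace Ω] [MeasurableSpace 𝒳]

/-- The truncation operator `T_W`, applied to a value. -/
noncomputable def truncate (W r : ℝ) : ℝ :=
  if |r| ≤ W then r else W * Real.sign r

/-- The space of samples: for each date `j < J` and each `m < M`, a pair
`(X_j^{(m)}, X_{j+1}^{(m)})`. -/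
abbrev Sample (𝒳 : Type*) (J M : ℕ) : Type _ := Fin J × Fin M → 𝒳 × 𝒳

/-- The law `μ_j` of `X_j`. -/
noncomputable def marginal (m : MarkovModel Ω 𝒳) (j : ℕ) : Measure 𝒳 :=
  m.P.map (m.X j)

/-- The law `ℙ_M` of the sample: the pairs are independent for different dates and different
indices, and those of date `j` have the joint law of `(X_j, X_{j+1})`. -/
noncomputable def sampleLaw (m : MarkovModel Ω 𝒳) (M : ℕ) : Measure (Sample 𝒳 m.J M) :=
  Measure.pi fun i : Fin m.J × Fin M =>
    m.P.map fun ω => (m.X i.1 ω, m.X ((i.1 : ℕ) + 1) ω)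

/-- The information set `𝒢_{j,M}`: the σ-algebra generated by the samples of the dates `≥ j`. -/
abbrev sampleInfo (𝒳 : Type*) [MeasurableSpace 𝒳] (J M j : ℕ) : MeasurableSpace (Sample 𝒳 J M) :=
  ⨆ i : {i : Fin J × Fin M // j ≤ i.1},
    MeasurableSpace.comap (fun D : Sample 𝒳 J M => D i.1) inferInstance

/-- The estimate `Ĉ_j(z, x) = T_W proj_j(z, x)`, with `proj_j(z, ·)` the untruncated regression
estimate computed from the sample `D`. -/
noncomputable def estC {J M : ℕ} (W : ℝ) (proj : ℕ → 𝓛 → Sample 𝒳 J M → 𝒳 → ℝ) (j : ℕ) (z : 𝓛)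
    (D : Sample 𝒳 J M) (x : 𝒳) : ℝ :=
  truncate W (proj j z D x)

/-- The estimate `v_{j,M}(y, x)` of the value function. -/
noncomputable def estV {J M : ℕ} (d : ControlData 𝒳 𝓚 𝓛) (W : ℝ)
    (proj : ℕ → 𝓛 → Sample 𝒳 J M → 𝒳 → ℝ) (j : ℕ) (y : 𝓛) (D : Sample 𝒳 J M) (x : 𝒳) : ℝ :=
  if j < J then ⨆ a : d.K j y x, (d.H j a y x + estC W proj j (d.φ (j + 1) a y) D x)
  else ⨆ a : d.K j y x, d.H j a y x

/-- `proj` is an outcome of the backward empirical least-squares regression over the classes `Ψ_j`: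
`proj_j(z, ·)` is a minimiser over `Ψ_j` of the empirical squared distance to `v_{j+1,M}(z, ·)`,
based on the sample of date `j`, and it is a (jointly measurable) function of the samples of the
dates `≥ j` and of `x`. -/
structure IsRegression {J M : ℕ} (d : ControlData 𝒳 𝓚 𝓛) (W : ℝ) (Ψ : ℕ → Set (𝒳 → ℝ))
    (proj : ℕ → 𝓛 → Sample 𝒳 J M → 𝒳 → ℝ) : Prop where
  mem : ∀ (j : Fin J) z D, proj j z D ∈ Ψ j
  isMin : ∀ (j : Fin J) z D, ∀ ψ ∈ Ψ j,
    ∑ i : Fin M, |estV d W proj (j + 1) z D (D (j, i)).2 - proj j z D (D (j, i)).1| ^ 2 ≤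
      ∑ i : Fin M, |estV d W proj (j + 1) z D (D (j, i)).2 - ψ (D (j, i)).1| ^ 2
  meas : ∀ (j : Fin J) z,
    @Measurable (Sample 𝒳 J M × 𝒳) ℝ ((sampleInfo 𝒳 J M j).prod inferInstance) inferInstance
      (fun p => proj j z p.1 p.2)

/-- `C̃_j(z, x) = E_{𝒢_{j+1,M}}[v_{j+1,M}(z, X^{j,x}_{j+1})]`: the trajectory is independent of the
sample, so the expectation is taken with the sample `D` kept fixed. -/
noncomputable def condC (m : MarkovModel Ω 𝒳) (d : ControlData 𝒳 𝓚 𝓛) {M : ℕ} (W : ℝ)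
    (proj : ℕ → 𝓛 → Sample 𝒳 m.J M → 𝒳 → ℝ) (j : ℕ) (z : 𝓛) (D : Sample 𝒳 m.J M) (x : 𝒳) : ℝ :=
  ∫ ω, estV d W proj (j + 1) z D (m.X (j + 1) ω) ∂(m.Pc j x)

/-- The error `ℰ_j`, the `L₂(μ_j ⊗ ℙ_M)` norm of `sup_z |Ĉ_j(z, ·) - C*_j(z, ·)|` for `j < J`,
and `ℰ_J = 0`. -/
noncomputable def regError (m : MarkovModel Ω 𝒳) (d : ControlData 𝒳 𝓚 𝓛) {M : ℕ} (W : ℝ)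
    (proj : ℕ → 𝓛 → Sample 𝒳 m.J M → 𝒳 → ℝ) (j : ℕ) : ENNReal :=
  if j < m.J then
    eLpNorm (fun p : 𝒳 × Sample 𝒳 m.J M =>
      ⨆ z : 𝓛, |estC W proj j z p.2 p.1 - contFunction m d j z p.1|) 2
      ((marginal m j).prod (sampleLaw m M))
  else 0

/-- The approximation error `inf_{w ∈ Ψ} ‖C̃_j(z, ·) - w‖` in `L₂(μ_j ⊗ ℙ_M)`. -/
noncomputable def approxError (m : MarkovModel Ω 𝒳) (d : ControlData 𝒳 𝓚 𝓛) {M : ℕ} (W : ℝ)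
    (proj : ℕ → 𝓛 → Sample 𝒳 m.J M → 𝒳 → ℝ) (Ψ : Set (𝒳 → ℝ)) (j : ℕ) (z : 𝓛) : ENNReal :=
  ⨅ w ∈ Ψ, eLpNorm (fun p : 𝒳 × Sample 𝒳 m.J M => condC m d W proj j z p.2 p.1 - w p.1) 2
    ((marginal m j).prod (sampleLaw m M))

/-- The stochastic error `ε`, with `ε² = c W⁴ (1 + log M) / M · VC(Ψ)`. -/
noncomputable def stochError (c W : ℝ) (M : ℕ) (Ψ : Set (𝒳 → ℝ)) : ENNReal :=
  (ENNReal.ofReal (c * W ^ 4 * ((1 + Real.log M) / M)) * (vcDim Ψ : ENNReal)) ^ (1 / 2 : ℝ)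

end Regression

end RegressionControl

/-! The error at a date splits into a fresh regression error and a propagated one. Since `|C*| ≤ W`,
`T_W` is a contraction and `T_W ∘ T_{2W} = T_W`, pointwise `|Ĉ_j - C*_j| ≤ |T_{2W} P_j - C̃_j| +
|C̃_j - C*_j|`.

Propagation (`eLpNorm_iSup_condC_sub_le`): by dynamic programming (`valueFunction_eq_dpValue`),
`C̃_j` and `C*_j` are conditional means of `v_{j+1,M}` and `v*_{j+1}`. Maxima over actions are
nonexpansive, so the difference is at most the conditional mean of `sup_z |Ĉ_{j+1} - C*_{j+1}|`.
Jensen's inequality, and the fact that the transition carries `μ_j` to `μ_{j+1}`, give `ℰ_{j+1}`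
with factor one.

Regression (`lintegral_sq_error_le`): with the samples of later dates frozen, the labels are a fixed
function of `X_{j+1}` bounded by `2W`, and `C̃_j` is its regression function. The excess loss has
mean `q`, the mean square error, and the squared contrast is at most a constant times `(u - t)²`.
This lets a negative multiple of `(u - t)²` absorb the fluctuations. A ghost sample and random swaps
reduce the claim to an average over signs; on the two samples the truncated class is, up to `1/n`, a
finite family of size polynomial in `n` (Sauer–Shelah), and an exponential moment bound turns this
into `V log n` without any chaining. The empirical excess risk of the minimiser is at most that of
any fixed `w` in the class, whence the `√2` in front of the approximation error.

The factor `|𝓛|` comes from bounding the supremum over `z` of the regression errors by their sum. -/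

namespace RegressionControl

/-! ### Truncation as a contraction. -/

section Truncation

lemma truncate_eq_clamp {W : ℝ} (hW : 0 ≤ W) (r : ℝ) : truncate W r = max (-W) (min W r) := by
  unfold truncate
  split_ifs with h
  · rw [abs_le] at h
    rw [min_eq_right h.2, max_eq_right h.1]
  · rw [not_le, lt_abs] at h
    rcases h with h | h
    · rw [Real.sign_of_pos (by linarith), min_eq_left h.le, max_eq_right (by linarith), mul_one]
    · rw [Real.sign_of_neg (by linarith), min_eq_right (by linarith), max_eq_left (by linarith)]
      ring

lemma abs_truncate_le {W : ℝ} (hW : 0 ≤ W) (r : ℝ) : |truncate W r| ≤ W := by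
  rw [truncate_eq_clamp hW, abs_le]
  exact ⟨le_max_left _ _, max_le (by linarith) (min_le_left _ _)⟩

lemma truncate_of_abs_le {W r : ℝ} (h : |r| ≤ W) : truncate W r = r := if_pos h

lemma abs_truncate_sub_truncate_le {W : ℝ} (hW : 0 ≤ W) (r s : ℝ) :
    |truncate W r - truncate W s| ≤ |r - s| := by
  rw [truncate_eq_clamp hW, truncate_eq_clamp hW]
  rw [max_comm (-W), max_comm (-W)]
  refine (abs_max_sub_max_le_abs _ _ _).trans ((abs_min_sub_min_le_max W r W s).trans ?_)
  simp

lemma abs_truncate_sub_le {W : ℝ} {r s : ℝ} (hs : |s| ≤ W) :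
    |truncate W r - s| ≤ |r - s| := by
  have := abs_truncate_sub_truncate_le ((abs_nonneg s).trans hs) r s
  rwa [truncate_of_abs_le hs] at this

/-- Labels are only bounded by `2 * W`, so the regression bound is proved for the estimate truncated
at `2 * W`; this transfers it to the actual estimate, truncated at `W`. -/
lemma truncate_truncate {W L : ℝ} (hW : 0 ≤ W) (hL : W ≤ L) (r : ℝ) :
    truncate W (truncate L r) = truncate W r := by
  rw [truncate_eq_clamp hW, truncate_eq_clamp hW, truncate_eq_clamp (hW.trans hL)]
  rcases le_total r (-L) with h | h
  · rw [min_eq_right (by linarith : r ≤ L), max_eq_left h, min_eq_right (by linarith),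
      min_eq_right (by linarith), max_eq_left (by linarith), max_eq_left (by linarith)]
  · rcases le_total r L with h' | h'
    · rw [min_eq_right h', max_eq_right h]
    · rw [min_eq_left h', max_eq_right (by linarith : -L ≤ L), min_eq_left hL,
        min_eq_left (by linarith)]

lemma measurable_truncate {W : ℝ} (hW : 0 ≤ W) : Measurable (truncate W) := by
  have : truncate W = fun r => max (-W) (min W r) := funext (truncate_eq_clamp hW)
  rw [this]
  fun_prop

end Truncation

/-! ### A maximal inequality for sign averages with a negative offset. -/

section Signs

/-- The sign `±1` attached to a swap indicator: `-1` if the pair is swapped. -/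
noncomputable def swapSign (b : Bool) : ℝ := if b then -1 else 1

/-- The sum over sign vectors factorises over coordinates, each factor being `2 cosh (d i / k) exp
(-s i / (2 k))`. As `cosh x ≤ exp (x² / 2)`, the offset cancels the sub-Gaussian exponent exactly
when `d² ≤ k s`; this dictates the rate `k⁻¹`. -/
lemma sum_exp_swapSign_le {n : ℕ} {k : ℝ} (hk : 0 < k) (d s : Fin n → ℝ)
    (hds : ∀ i, d i ^ 2 ≤ k * s i) :
    ∑ σ : Fin n → Bool, Real.exp (k⁻¹ * ∑ i, (swapSign (σ i) * d i - s i / 2)) ≤ 2 ^ n := by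
  have h1 : ∀ σ : Fin n → Bool, Real.exp (k⁻¹ * ∑ i, (swapSign (σ i) * d i - s i / 2)) =
      ∏ i, Real.exp (k⁻¹ * (swapSign (σ i) * d i - s i / 2)) := by
    intro σ
    rw [Finset.mul_sum, Real.exp_sum]
  simp_rw [h1]
  have h2 := Finset.prod_univ_sum (fun _ : Fin n => (Finset.univ : Finset Bool))
    (fun i b => Real.exp (k⁻¹ * (swapSign b * d i - s i / 2)))
  rw [Fintype.piFinset_univ] at h2
  rw [← h2]
  have h3 : ∀ i ∈ (Finset.univ : Finset (Fin n)),
      ∑ b : Bool, Real.exp (k⁻¹ * (swapSign b * d i - s i / 2)) ≤ 2 := by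
    intro i _
    have e : ∑ b : Bool, Real.exp (k⁻¹ * (swapSign b * d i - s i / 2)) =
        2 * (Real.cosh (k⁻¹ * d i) * Real.exp (-(k⁻¹ * (s i / 2)))) := by
      rw [Fintype.sum_bool, Real.cosh_eq]
      simp only [swapSign, if_true, Bool.false_eq_true, if_false]
      rw [show k⁻¹ * (-1 * d i - s i / 2) = -(k⁻¹ * d i) + -(k⁻¹ * (s i / 2)) by ring,
        show k⁻¹ * (1 * d i - s i / 2) = (k⁻¹ * d i) + -(k⁻¹ * (s i / 2)) by ring,
        Real.exp_add, Real.exp_add]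
      ring
    rw [e]
    have h4 : Real.cosh (k⁻¹ * d i) * Real.exp (-(k⁻¹ * (s i / 2))) ≤ 1 := by
      calc _ ≤ Real.exp ((k⁻¹ * d i) ^ 2 / 2) * Real.exp (-(k⁻¹ * (s i / 2))) := by
            gcongr; exact Real.cosh_le_exp_half_sq _
        _ = Real.exp ((k⁻¹ * d i) ^ 2 / 2 + -(k⁻¹ * (s i / 2))) := (Real.exp_add _ _).symm
        _ ≤ 1 := by
            rw [Real.exp_le_one_iff]
            have : (k⁻¹ * d i) ^ 2 ≤ k⁻¹ * s i := by
              calc (k⁻¹ * d i) ^ 2 = k⁻¹ ^ 2 * d i ^ 2 := by ring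
                _ ≤ k⁻¹ ^ 2 * (k * s i) := by gcongr; exact hds i
                _ = k⁻¹ * s i := by field_simp
            linarith
    linarith
  refine (Finset.prod_le_prod (fun i _ => by positivity) h3).trans ?_
  simp

/-- The index `γ σ` may depend on the signs, so a maximum over `G` must be controlled. It is
dominated by the sum of the exponentials over `G`, at the price `k log |G|`. -/
lemma sum_swapSign_le {n : ℕ} {G : Type*} [Fintype G] {k : ℝ} (hk : 0 < k) (d s : G → Fin n → ℝ)
    (hds : ∀ g i, d g i ^ 2 ≤ k * s g i) (γ : (Fin n → Bool) → G) :
    ∑ σ, ∑ i, (swapSign (σ i) * d (γ σ) i - s (γ σ) i / 2) ≤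
      2 ^ n * (k * Real.log (Fintype.card G)) := by
  have hG : 0 < (Fintype.card G : ℝ) := by
    exact_mod_cast Fintype.card_pos_iff.2 ⟨γ fun _ => true⟩
  set N : ℝ := (Fintype.card G : ℝ)
  let t : G → (Fin n → Bool) → ℝ := fun g σ => k⁻¹ * ∑ i, (swapSign (σ i) * d g i - s g i / 2)
  have h1 : ∀ σ, t (γ σ) σ ≤ Real.log N - 1 + N⁻¹ * ∑ g, Real.exp (t g σ) := by
    intro σ
    -- The tangent to the exponential at `log N` linearises the usual log-sum-exp step, so Jensen's
    -- inequality for the logarithm is not needed.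
    have ha := Real.add_one_le_exp (t (γ σ) σ - Real.log N)
    rw [Real.exp_sub, Real.exp_log hG] at ha
    have hb : Real.exp (t (γ σ) σ) ≤ ∑ g, Real.exp (t g σ) :=
      Finset.single_le_sum (f := fun g => Real.exp (t g σ)) (fun g _ => (Real.exp_pos _).le)
        (Finset.mem_univ _)
    have hc : Real.exp (t (γ σ) σ) / N ≤ N⁻¹ * ∑ g, Real.exp (t g σ) := by
      rw [div_eq_inv_mul]; gcongr
    linarith
  have h2 : ∑ σ, t (γ σ) σ ≤ 2 ^ n * Real.log N := by
    calc ∑ σ, t (γ σ) σ ≤ ∑ σ, (Real.log N - 1 + N⁻¹ * ∑ g, Real.exp (t g σ)) :=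
          Finset.sum_le_sum fun σ _ => h1 σ
      _ = 2 ^ n * (Real.log N - 1) + N⁻¹ * ∑ g, ∑ σ, Real.exp (t g σ) := by
          rw [Finset.sum_add_distrib, ← Finset.mul_sum, Finset.sum_comm]
          simp
          ring
      _ ≤ 2 ^ n * (Real.log N - 1) + N⁻¹ * ∑ _g : G, (2 : ℝ) ^ n := by
          gcongr with g _
          exact sum_exp_swapSign_le hk (d g) (s g) (hds g)
      _ = 2 ^ n * Real.log N := by
          rw [Finset.sum_const, Finset.card_univ, nsmul_eq_mul]
          change _ + N⁻¹ * (N * _) = _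
          field_simp
          ring
  have h3 : ∑ σ, ∑ i, (swapSign (σ i) * d (γ σ) i - s (γ σ) i / 2) = k * ∑ σ, t (γ σ) σ := by
    rw [Finset.mul_sum]
    exact Finset.sum_congr rfl fun σ _ => (mul_inv_cancel_left₀ hk.ne' _).symm
  rw [h3]
  calc k * ∑ σ, t (γ σ) σ ≤ k * (2 ^ n * Real.log N) := by gcongr
    _ = _ := by ring

end Signs

/-! ### Sauer–Shelah counting and finite covers of truncated classes. -/

section Covering

variable {α 𝒳 : Type*}

/-- A subset with at most `V` elements is the set of values of some map from `Fin V` to `Option P`,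
the value `none` filling the unused slots. -/
lemma card_powerset_filter_card_le (P : Finset α) (V : ℕ) :
    (P.powerset.filter fun S => S.card ≤ V).card ≤ (P.card + 1) ^ V := by
  classical
  let f : (Fin V → Option P) → Finset α := fun g =>
    P.filter fun a => ∃ i, ∃ h : a ∈ P, g i = some ⟨a, h⟩
  have hsub : (P.powerset.filter fun S => S.card ≤ V) ⊆ Finset.univ.image f := by
    intro S hS
    rw [Finset.mem_filter, Finset.mem_powerset] at hS
    obtain ⟨hSP, hSV⟩ := hS
    rw [Finset.mem_image]
    refine ⟨fun i => if h : (i : ℕ) < S.card then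
      some ⟨S.equivFin.symm ⟨i, h⟩, hSP (S.equivFin.symm ⟨i, h⟩).2⟩ else none, Finset.mem_univ _, ?_⟩
    ext a
    simp only [f, Finset.mem_filter]
    constructor
    · rintro ⟨_, i, h, hi⟩
      split_ifs at hi with h'
      simp only [Option.some.injEq, Subtype.mk.injEq] at hi
      rw [← hi]
      exact (S.equivFin.symm ⟨i, h'⟩).2
    · intro ha
      refine ⟨hSP ha, ⟨S.equivFin ⟨a, ha⟩, (S.equivFin ⟨a, ha⟩).2.trans_le hSV⟩, hSP ha, ?_⟩
      simp
  refine (Finset.card_le_card hsub).trans (Finset.card_image_le.trans ?_)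
  simp

/-- Pajor's form of Sauer–Shelah: a finite family has no more members than the sets it shatters, and
every set shattered by the traces is shattered by `𝒜`, hence has at most `V` elements. -/
lemma card_traces_le {𝒜 : Set (Set α)} {V : ℕ} (hV : vcDimSets 𝒜 ≤ V) (P : Finset α)
    (𝒯 : Finset (Finset α)) (h𝒯 : ∀ T ∈ 𝒯, T ⊆ P ∧ ∃ A ∈ 𝒜, ∀ p ∈ P, p ∈ A ↔ p ∈ T) :
    𝒯.card ≤ (P.card + 1) ^ V := by
  classical
  refine (Finset.card_le_card_shatterer 𝒯).trans
    ((Finset.card_le_card ?_).trans (card_powerset_filter_card_le P V))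
  intro S hS
  rw [Finset.mem_shatterer] at hS
  rw [Finset.mem_filter, Finset.mem_powerset]
  obtain ⟨t, ht, hSt⟩ := hS.exists_superset
  have hSP : S ⊆ P := hSt.trans (h𝒯 t ht).1
  refine ⟨hSP, ?_⟩
  have hsh : IsShattered 𝒜 S := by
    intro T hT
    obtain ⟨u, hu, hSu⟩ := hS hT
    obtain ⟨-, A, hA, hAu⟩ := h𝒯 u hu
    refine ⟨A, hA, fun p hp => ?_⟩
    rw [hAu p (hSP hp), ← hSu, Finset.mem_inter]
    exact ⟨fun h => ⟨hp, h⟩, fun h => h.2⟩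
  have h2 : (S.card : ℕ∞) ≤ vcDimSets 𝒜 :=
    le_iSup₂ (f := fun (S : Finset α) (_ : IsShattered 𝒜 S) => (S.card : ℕ∞)) S hsh
  exact_mod_cast h2.trans hV

/-- If `f x < g x`, the single point `(x, g x)` lies in the subgraph of `g` but not in that of `f`,
so it is shattered. -/
lemma subsingleton_of_vcDim_eq_zero {Ψ : Set (𝒳 → ℝ)} (hV : vcDim Ψ = 0) : Ψ.Subsingleton := by
  classical
  have key : ∀ f ∈ Ψ, ∀ g ∈ Ψ, ∀ x, g x ≤ f x := by
    intro f hf g hg x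
    by_contra! hlt
    have hsh : IsShattered ((fun f : 𝒳 → ℝ => {p : 𝒳 × ℝ | p.2 ≤ f p.1}) '' Ψ) {(x, g x)} := by
      intro T hT
      rcases Finset.subset_singleton_iff.1 hT with rfl | rfl
      · exact ⟨_, ⟨f, hf, rfl⟩, by simpa using hlt⟩
      · exact ⟨_, ⟨g, hg, rfl⟩, by simp⟩
    have h2 : ((({(x, g x)} : Finset (𝒳 × ℝ)).card : ℕ) : ℕ∞) ≤ vcDim Ψ :=
      le_iSup₂ (f := fun (S : Finset (𝒳 × ℝ)) (_ : IsShattered _ S) => (S.card : ℕ∞)) _ hsh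
    rw [hV] at h2
    simp at h2
  exact fun f hf g hg => funext fun x => le_antisymm (key g hg f hf x) (key f hf g hg x)

/-- Functions of a class of finite Vapnik–Chervonenkis dimension, truncated at level `L`, are
determined on finitely many points, up to an error `2 L / n`, by a label taking polynomially many
values. -/
lemma exists_truncate_cover {Ψ : Set (𝒳 → ℝ)} {V : ℕ} (hV : vcDim Ψ ≤ V) (pts : Finset 𝒳)
    {L : ℝ} (hL : 0 < L) {n : ℕ} (hn : 1 ≤ n) :
    ∃ (τ : (𝒳 → ℝ) → Finset (𝒳 × ℝ)) (𝒯 : Finset (Finset (𝒳 × ℝ))),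
      (∀ f ∈ Ψ, τ f ∈ 𝒯) ∧ (∀ T ∈ 𝒯, ∃ f ∈ Ψ, τ f = T) ∧
      𝒯.card ≤ (pts.card * (n + 1) + 1) ^ V ∧
      ∀ f g, τ f = τ g → ∀ x ∈ pts, |truncate L (f x) - truncate L (g x)| ≤ 2 * L / n := by
  classical
  -- The label of `f` is the trace of its subgraph on the points times `n + 1` equally spaced levels
  -- of `[-L, L]`. Two truncated values further apart than the spacing are separated by a level.
  let grid : ℕ → ℝ := fun k => -L + 2 * L / n * k
  let P : Finset (𝒳 × ℝ) := pts ×ˢ (Finset.range (n + 1)).image grid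
  have hP : P.card ≤ pts.card * (n + 1) := by
    rw [Finset.card_product]
    gcongr
    exact Finset.card_image_le.trans (by simp)
  let τ : (𝒳 → ℝ) → Finset (𝒳 × ℝ) := fun f => P.filter fun p => p.2 ≤ f p.1
  have hn' : (0 : ℝ) < n := by exact_mod_cast hn
  have hδ : 0 < 2 * L / n := by positivity
  have key : ∀ f g, τ f = τ g → ∀ x ∈ pts, truncate L (g x) - truncate L (f x) ≤ 2 * L / n := by
    intro f g hfg x hx
    by_contra! hlt
    have hgb := abs_le.1 (abs_truncate_le hL.le (g x))
    have hfb := abs_le.1 (abs_truncate_le hL.le (f x))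
    set k := ⌊(truncate L (g x) + L) / (2 * L / n)⌋₊
    have hk0 : 0 ≤ (truncate L (g x) + L) / (2 * L / n) := div_nonneg (by linarith) hδ.le
    have hk1 : (k : ℝ) * (2 * L / n) ≤ truncate L (g x) + L :=
      (le_div_iff₀ hδ).1 (Nat.floor_le hk0)
    have hk2 : truncate L (g x) + L < (k + 1) * (2 * L / n) :=
      (div_lt_iff₀ hδ).1 (Nat.lt_floor_add_one _)
    have hkn : k < n + 1 := by
      have : (k : ℝ) * (2 * L / n) ≤ n * (2 * L / n) := by
        have : (n : ℝ) * (2 * L / n) = 2 * L := by field_simp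
        linarith
      have := le_of_mul_le_mul_right this hδ
      have : k ≤ n := by exact_mod_cast this
      omega
    have hmem : (x, grid k) ∈ P := Finset.mem_product.2
      ⟨hx, Finset.mem_image_of_mem _ (Finset.mem_range.2 hkn)⟩
    have hgk : grid k ≤ truncate L (g x) := by simp only [grid]; linarith
    have hfk : truncate L (f x) < grid k := by simp only [grid]; linarith
    have hg : (x, grid k) ∈ τ g := by
      refine Finset.mem_filter.2 ⟨hmem, ?_⟩
      change grid k ≤ g x
      rw [truncate_eq_clamp hL.le] at hgk
      -- The level lies strictly above a truncated value, hence above `-L`; so the lower clamp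
      -- cannot be what puts it below `truncate L (g x)`.
      rcases le_max_iff.1 hgk with h | h
      · linarith
      · exact h.trans (min_le_right _ _)
    rw [← hfg] at hg
    have hf : grid k ≤ f x := (Finset.mem_filter.1 hg).2
    rw [truncate_eq_clamp hL.le] at hfk
    have := (le_max_right _ _).trans_lt hfk
    rcases min_lt_iff.1 this with h | h <;> linarith
  let 𝒯 : Finset (Finset (𝒳 × ℝ)) := P.powerset.filter fun T => ∃ f ∈ Ψ, τ f = T
  refine ⟨τ, 𝒯, fun f hf => Finset.mem_filter.2
    ⟨Finset.mem_powerset.2 (Finset.filter_subset _ _), f, hf, rfl⟩,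
    fun T hT => (Finset.mem_filter.1 hT).2, ?_, ?_⟩
  · refine (card_traces_le hV P 𝒯 ?_).trans (Nat.pow_le_pow_left (by omega) V)
    intro T hT
    obtain ⟨hTP, f, hf, hfT⟩ := Finset.mem_filter.1 hT
    refine ⟨Finset.mem_powerset.1 hTP, _, ⟨f, hf, rfl⟩, fun p hp => ?_⟩
    rw [← hfT, Finset.mem_filter]
    exact ⟨fun h => ⟨hp, h⟩, fun h => h.2⟩
  · intro f g hfg x hx
    rw [abs_le]
    have h1 := key f g hfg x hx
    have h2 := key g f hfg.symm x hx
    constructor <;> linarith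

end Covering

/-! ### The contrast, its self-bounding variance and its discretisation. -/

section Contrast

/-- The contrast whose centred empirical means control the excess risk of a least-squares
estimate: here `u` is the predicted value, `y` the label and `t` the regression function. -/
noncomputable def contrast (u y t : ℝ) : ℝ := 2 * ((u - y) ^ 2 - (t - y) ^ 2) - (u - t) ^ 2 / 2

/-- The contrast is divisible by `u - t`, with a cofactor of modulus at most `9 * L`. This
self-bounding property, special to the square loss, yields the rate `1 / n` rather than its square
root. -/
lemma contrast_sq_le {L u y t : ℝ} (hu : |u| ≤ L) (hy : |y| ≤ L) (ht : |t| ≤ L) :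
    contrast u y t ^ 2 ≤ 81 * L ^ 2 * (u - t) ^ 2 := by
  have e : contrast u y t = (u - t) * (2 * (u + t - 2 * y) - (u - t) / 2) := by
    unfold contrast; ring
  rw [abs_le] at hu hy ht
  rw [e, mul_pow, mul_comm]
  gcongr
  rw [show 81 * L ^ 2 = (9 * L) ^ 2 by ring]
  exact sq_le_sq' (by linarith) (by linarith)

lemma abs_contrast_sub_le {L δ u u' y t : ℝ} (hu : |u| ≤ L) (hu' : |u'| ≤ L) (hy : |y| ≤ L)
    (ht : |t| ≤ L) (h : |u - u'| ≤ δ) : |contrast u y t - contrast u' y t| ≤ 10 * L * δ := by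
  have e : contrast u y t - contrast u' y t =
      (2 * (u + u' - 2 * y) - (u + u' - 2 * t) / 2) * (u - u') := by
    unfold contrast; ring
  have hL : 0 ≤ L := (abs_nonneg u).trans hu
  rw [e, abs_mul]
  rw [abs_le] at hu hu' hy ht
  gcongr
  rw [abs_le]
  constructor <;> linarith

lemma abs_sq_sub_sq_le {L δ u u' t : ℝ} (hu : |u| ≤ L) (hu' : |u'| ≤ L) (ht : |t| ≤ L)
    (h : |u - u'| ≤ δ) : |(u - t) ^ 2 - (u' - t) ^ 2| ≤ 4 * L * δ := by
  have e : (u - t) ^ 2 - (u' - t) ^ 2 = (u + u' - 2 * t) * (u - u') := by ring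
  have hL : 0 ≤ L := (abs_nonneg u).trans hu
  rw [e, abs_mul]
  rw [abs_le] at hu hu' ht
  gcongr
  rw [abs_le]
  constructor <;> linarith

lemma abs_contrast_le {L u y t : ℝ} (hu : |u| ≤ L) (hy : |y| ≤ L) (ht : |t| ≤ L) :
    |contrast u y t| ≤ 18 * L ^ 2 := by
  have hL : 0 ≤ L := (abs_nonneg u).trans hu
  refine abs_le_of_sq_le_sq ((contrast_sq_le hu hy ht).trans ?_) (by positivity)
  rw [abs_le] at hu ht
  calc 81 * L ^ 2 * (u - t) ^ 2 ≤ 81 * L ^ 2 * (2 * L) ^ 2 := by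
        gcongr ?_ * ?_
        exact sq_le_sq' (by linarith) (by linarith)
    _ = _ := by ring

variable {𝒳 : Type*}

/-- Symmetrised, offset empirical process over a class of finite Vapnik–Chervonenkis dimension:
deterministic bound for the average over all swaps, with an arbitrary choice of a function of the
class for every swap. -/
lemma sum_swapSign_contrast_le {Ψ : Set (𝒳 → ℝ)} {V : ℕ} (hV : vcDim Ψ ≤ V) {L : ℝ} (hL : 0 < L)
    {n : ℕ} (hn : 1 ≤ n) (x x' : Fin n → 𝒳) (y y' t t' : Fin n → ℝ)
    (hy : ∀ i, |y i| ≤ L) (hy' : ∀ i, |y' i| ≤ L) (ht : ∀ i, |t i| ≤ L) (ht' : ∀ i, |t' i| ≤ L)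
    (F : (Fin n → Bool) → 𝒳 → ℝ) (hF : ∀ σ, F σ ∈ Ψ) :
    ∑ σ : Fin n → Bool, ∑ i,
      (swapSign (σ i) * (contrast (truncate L (F σ (x' i))) (y' i) (t' i) -
          contrast (truncate L (F σ (x i))) (y i) (t i)) -
        ((truncate L (F σ (x i)) - t i) ^ 2 + (truncate L (F σ (x' i)) - t' i) ^ 2) / 2) ≤
      2 ^ n * (162 * L ^ 2 * (V * Real.log (2 * n * (n + 1) + 1)) + 48 * L ^ 2) := by
  classical
  let pts : Finset 𝒳 := Finset.univ.image x ∪ Finset.univ.image x'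
  have hpts : pts.card ≤ 2 * n := by
    refine (Finset.card_union_le _ _).trans ?_
    have h1 : (Finset.univ.image x).card ≤ n := Finset.card_image_le.trans (by simp)
    have h2 : (Finset.univ.image x').card ≤ n := Finset.card_image_le.trans (by simp)
    omega
  obtain ⟨τ, 𝒯, h𝒯, hrep, hcard, hclose⟩ := exists_truncate_cover hV pts hL hn
  choose! rep hrepΨ hrepτ using hrep
  let R : 𝒯 → 𝒳 → ℝ := fun T => rep T
  let γ : (Fin n → Bool) → 𝒯 := fun σ => ⟨τ (F σ), h𝒯 _ (hF σ)⟩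
  let d : 𝒯 → Fin n → ℝ := fun T i => contrast (truncate L (R T (x' i))) (y' i) (t' i) -
          contrast (truncate L (R T (x i))) (y i) (t i)
  let s : 𝒯 → Fin n → ℝ := fun T i =>
    (truncate L (R T (x i)) - t i) ^ 2 + (truncate L (R T (x' i)) - t' i) ^ 2
  have htr := abs_truncate_le hL.le
  -- The constant is `162 = 2 * 81`, from `(a - b)² ≤ 2 a² + 2 b²` and `contrast_sq_le` on each
  -- sample.
  have hds : ∀ T i, d T i ^ 2 ≤ (162 * L ^ 2) * s T i := by
    intro T i
    have h1 := contrast_sq_le (htr (R T (x i))) (hy i) (ht i)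
    have h2 := contrast_sq_le (htr (R T (x' i))) (hy' i) (ht' i)
    simp only [d, s]
    nlinarith [sq_nonneg (contrast (truncate L (R T (x' i))) (y' i) (t' i) +
          contrast (truncate L (R T (x i))) (y i) (t i))]
  have hmain := sum_swapSign_le (by positivity : (0 : ℝ) < 162 * L ^ 2) d s hds γ
  have hn' : (0 : ℝ) < n := by exact_mod_cast hn
  have hlog : Real.log (Fintype.card 𝒯) ≤ V * Real.log (2 * n * (n + 1) + 1) := by
    have hne : 0 < Fintype.card 𝒯 := Fintype.card_pos_iff.2 ⟨γ fun _ => true⟩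
    have hc : (Fintype.card 𝒯 : ℝ) ≤ (2 * n * (n + 1) + 1) ^ V := by
      rw [Fintype.card_coe]
      have := hcard.trans (Nat.pow_le_pow_left
        (Nat.add_le_add_right (Nat.mul_le_mul_right (n + 1) hpts) 1) V)
      exact_mod_cast this
    rw [← Real.log_pow]
    exact Real.log_le_log (by exact_mod_cast hne) hc
  have hdiff : ∀ σ i,
      swapSign (σ i) * (contrast (truncate L (F σ (x' i))) (y' i) (t' i) -
          contrast (truncate L (F σ (x i))) (y i) (t i)) -
        ((truncate L (F σ (x i)) - t i) ^ 2 + (truncate L (F σ (x' i)) - t' i) ^ 2) / 2 ≤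
      (swapSign (σ i) * d (γ σ) i - s (γ σ) i / 2) + 48 * L ^ 2 / n := by
    intro σ i
    have hτ : τ (F σ) = τ (R (γ σ)) := (hrepτ _ (γ σ).2).symm
    have c1 := hclose _ _ hτ (x i)
      (Finset.mem_union_left _ (Finset.mem_image_of_mem _ (Finset.mem_univ i)))
    have c2 := hclose _ _ hτ (x' i)
      (Finset.mem_union_right _ (Finset.mem_image_of_mem _ (Finset.mem_univ i)))
    have a1 := abs_le.1 (abs_contrast_sub_le (htr _) (htr _) (hy i) (ht i) c1)
    have a2 := abs_le.1 (abs_contrast_sub_le (htr _) (htr _) (hy' i) (ht' i) c2)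
    have a3 := abs_le.1 (abs_sq_sub_sq_le (htr _) (htr _) (ht i) c1)
    have a4 := abs_le.1 (abs_sq_sub_sq_le (htr _) (htr _) (ht' i) c2)
    -- Replacing `F σ` by its representative costs `10 + 10` from the two contrasts and `(4 + 4) /
    -- 2` from the halved squares, that is `24`, times `L` times the grid spacing `2 * L / n`.
    have e : 48 * L ^ 2 / n = 24 * (L * (2 * L / n)) := by ring
    have e1 : ∀ r : ℝ, r * L * (2 * L / n) = r * (L * (2 * L / n)) := fun r => by ring
    rw [e1] at a1 a2 a3 a4
    rw [e]
    simp only [d, s]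
    rcases hb : σ i <;> simp only [swapSign, if_true, Bool.false_eq_true, if_false] <;> linarith
  calc _ ≤ ∑ σ : Fin n → Bool, ∑ i : Fin n,
        ((swapSign (σ i) * d (γ σ) i - s (γ σ) i / 2) + 48 * L ^ 2 / n) :=
        Finset.sum_le_sum fun σ _ => Finset.sum_le_sum fun i _ => hdiff σ i
    _ = ∑ σ, ∑ i, (swapSign (σ i) * d (γ σ) i - s (γ σ) i / 2) + 2 ^ n * (48 * L ^ 2) := by
        simp_rw [Finset.sum_add_distrib]
        congr 1
        simp
        field_simp
    _ ≤ 2 ^ n * (162 * L ^ 2 * (V * Real.log (2 * n * (n + 1) + 1))) + 2 ^ n * (48 * L ^ 2) := by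
        gcongr
        exact hmain.trans (by gcongr)
    _ = _ := by ring

end Contrast

/-! ### Ghost samples and swaps. -/

section Symmetrisation

variable {Z : Type*} [MeasurableSpace Z] {n : ℕ}

/-- Exchange the `i`-th entries of two samples for all `i` with `σ i = true`. -/
def swapPair (σ : Fin n → Bool) (p : (Fin n → Z) × (Fin n → Z)) : (Fin n → Z) × (Fin n → Z) :=
  (fun i => if σ i then p.2 i else p.1 i, fun i => if σ i then p.1 i else p.2 i)

/-- Seen as a single sample of pairs, two samples are swapped coordinate by coordinate, and each
`ρ.prod ρ` is invariant under exchange of its factors. -/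
lemma measurePreserving_swapPair (ρ : Measure Z) [IsProbabilityMeasure ρ] (σ : Fin n → Bool) :
    MeasurePreserving (swapPair σ)
      ((Measure.pi fun _ : Fin n => ρ).prod (Measure.pi fun _ : Fin n => ρ))
      ((Measure.pi fun _ : Fin n => ρ).prod (Measure.pi fun _ : Fin n => ρ)) := by
  have he := measurePreserving_arrowProdEquivProdArrow Z Z (Fin n) (fun _ => ρ) (fun _ => ρ)
  have hf : MeasurePreserving (fun (a : Fin n → Z × Z) i => (if σ i then Prod.swap else id) (a i))
      (Measure.pi fun _ : Fin n => ρ.prod ρ) (Measure.pi fun _ : Fin n => ρ.prod ρ) := by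
    refine measurePreserving_pi _ _ (f := fun i => if σ i then Prod.swap else id) fun i => ?_
    split_ifs
    · exact Measure.measurePreserving_swap
    · exact MeasurePreserving.id _
  have h := (he.comp hf).comp (he.symm _)
  convert h using 1
  funext p
  ext i <;> rcases h : σ i <;>
    simp [swapPair, MeasurableEquiv.arrowProdEquivProdArrow, Equiv.arrowProdEquivProdArrow, h]

/-- By swap invariance the integral equals that of the average over all swaps, for which a
deterministic bound suffices. -/
lemma integral_le_of_sum_swapPair_le (ρ : Measure Z) [IsProbabilityMeasure ρ]
    {Φ : (Fin n → Z) × (Fin n → Z) → ℝ} (hΦ : Measurable Φ) {B : ℝ} (hB : ∀ p, |Φ p| ≤ B) {C : ℝ}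
    (h : ∀ p, ∑ σ, Φ (swapPair σ p) ≤ 2 ^ n * C) :
    ∫ p, Φ p ∂((Measure.pi fun _ : Fin n => ρ).prod (Measure.pi fun _ : Fin n => ρ)) ≤ C := by
  have hsw := measurePreserving_swapPair (n := n) ρ
  set π := (Measure.pi fun _ : Fin n => ρ).prod (Measure.pi fun _ : Fin n => ρ)
  have h1 : ∀ σ, ∫ p, Φ (swapPair σ p) ∂π = ∫ p, Φ p ∂π := by
    intro σ
    conv_rhs => rw [← (hsw σ).map_eq]
    rw [integral_map (hsw σ).measurable.aemeasurable hΦ.aestronglyMeasurable]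
  have hint : ∀ σ, Integrable (fun p => Φ (swapPair σ p)) π := fun σ =>
    Integrable.of_bound (hΦ.comp (hsw σ).measurable).aestronglyMeasurable B
      (Filter.Eventually.of_forall fun p => hB _)
  have h2 : (2 : ℝ) ^ n * ∫ p, Φ p ∂π = ∫ p, ∑ σ, Φ (swapPair σ p) ∂π := by
    rw [integral_finsetSum _ fun σ _ => hint σ]
    simp [h1]
  have h3 : ∫ p, ∑ σ, Φ (swapPair σ p) ∂π ≤ ∫ _, 2 ^ n * C ∂π :=
    integral_mono (integrable_finsetSum _ fun σ _ => hint σ) (integrable_const _) h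
  rw [← h2] at h3
  simp only [integral_const, probReal_univ, smul_eq_mul, one_mul] at h3
  exact le_of_mul_le_mul_left h3 (by positivity)

/-- A ghost-sample argument for data-dependent functions: the offset symmetrised process bounds
the mean of `q` by twice the empirical mean of `g`. -/
lemma integral_integral_le_of_swap (ρ : Measure Z) [IsProbabilityMeasure ρ]
    {h q g : (Fin n → Z) → Z → ℝ} (hhm : Measurable fun p : (Fin n → Z) × Z => h p.1 p.2)
    (hqm : Measurable fun p : (Fin n → Z) × Z => q p.1 p.2)
    (hgm : Measurable fun p : (Fin n → Z) × Z => g p.1 p.2) {B : ℝ}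
    (hhB : ∀ D z, |h D z| ≤ B) (hqB : ∀ D z, |q D z| ≤ B) (hgB : ∀ D z, |g D z| ≤ B)
    (hghq : ∀ D z, 2 * g D z = h D z + q D z / 2) (hPg : ∀ D, ∫ z, g D z ∂ρ = ∫ z, q D z ∂ρ)
    {C : ℝ} (hC : ∀ p : (Fin n → Z) × (Fin n → Z), ∑ σ, ∑ i,
      ((h (swapPair σ p).1 ((swapPair σ p).2 i) - h (swapPair σ p).1 ((swapPair σ p).1 i)) -
        (q (swapPair σ p).1 ((swapPair σ p).1 i) + q (swapPair σ p).1 ((swapPair σ p).2 i)) / 2) ≤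
      2 ^ n * C) :
    n * ∫ D, ∫ z, q D z ∂ρ ∂(Measure.pi fun _ : Fin n => ρ) ≤
      2 * ∫ D, ∑ i, g D (D i) ∂(Measure.pi fun _ : Fin n => ρ) + C := by
  let Φ : (Fin n → Z) × (Fin n → Z) → ℝ := fun p =>
    ∑ i, ((h p.1 (p.2 i) - h p.1 (p.1 i)) - (q p.1 (p.1 i) + q p.1 (p.2 i)) / 2)
  have happ1 : ∀ i, Measurable fun p : (Fin n → Z) × (Fin n → Z) => (p.1, p.1 i) :=
    fun i => measurable_fst.prodMk ((measurable_pi_apply i).comp measurable_fst)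
  have happ2 : ∀ i, Measurable fun p : (Fin n → Z) × (Fin n → Z) => (p.1, p.2 i) :=
    fun i => measurable_fst.prodMk ((measurable_pi_apply i).comp measurable_snd)
  have hΦm : Measurable Φ := by
    refine Finset.measurable_fun_sum _ fun i _ => ?_
    exact ((hhm.comp (happ2 i)).sub (hhm.comp (happ1 i))).sub
      (((hqm.comp (happ1 i)).add (hqm.comp (happ2 i))).div_const 2)
  have hΦB : ∀ p, |Φ p| ≤ n * (3 * B) := by
    intro p
    refine (Finset.abs_sum_le_sum_abs _ _).trans ?_
    refine (Finset.sum_le_card_nsmul _ _ (3 * B) fun i _ => ?_).trans (by simp)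
    have h1 := abs_le.1 (hhB p.1 (p.2 i))
    have h2 := abs_le.1 (hhB p.1 (p.1 i))
    have h3 := abs_le.1 (hqB p.1 (p.2 i))
    have h4 := abs_le.1 (hqB p.1 (p.1 i))
    rw [abs_le]
    constructor <;> linarith
  have hswap := integral_le_of_sum_swapPair_le ρ hΦm hΦB hC
  set π := Measure.pi fun _ : Fin n => ρ
  have int_of : ∀ (f : (Fin n → Z) → ℝ) (B : ℝ), Measurable f → (∀ a, |f a| ≤ B) →
      Integrable f π :=
    fun f B hf hB => Integrable.of_bound hf.aestronglyMeasurable B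
      (Filter.Eventually.of_forall hB)
  -- Integrating out the ghost sample: by `2 g = h + q / 2`, the ghost terms are `2 g - q`, of mean
  -- that of `q`, while the terms at `D` itself collapse to `-2 g`.
  have hD1 : ∀ D, ∫ D', Φ (D, D') ∂π = n * ∫ z, q D z ∂ρ - 2 * ∑ i, g D (D i) := by
    intro D
    have hqD : Measurable (q D) := hqm.comp (measurable_prodMk_left (x := D))
    have hgD : Measurable (g D) := hgm.comp (measurable_prodMk_left (x := D))
    have e1 : ∀ D', Φ (D, D') = ∑ i, (2 * g D (D' i) - q D (D' i) - 2 * g D (D i)) := by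
      intro D'
      refine Finset.sum_congr rfl fun i _ => ?_
      simp only [hghq]; ring
    simp_rw [e1]
    have hi1 : ∀ i, Integrable (fun D' : Fin n → Z => 2 * g D (D' i)) π := fun i =>
      (int_of _ _ (hgD.comp (measurable_pi_apply i)) fun D' => hgB D _).const_mul 2
    have hi2 : ∀ i, Integrable (fun D' : Fin n → Z => q D (D' i)) π := fun i =>
      int_of _ _ (hqD.comp (measurable_pi_apply i)) fun D' => hqB D _
    have hi3 : ∀ i, Integrable (fun D' : Fin n → Z => 2 * g D (D' i) - q D (D' i)) π := fun i =>
      (hi1 i).sub (hi2 i)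
    have hi4 : ∀ i, Integrable
        (fun D' : Fin n → Z => 2 * g D (D' i) - q D (D' i) - 2 * g D (D i)) π := fun i =>
      (hi3 i).sub (integrable_const _)
    rw [integral_finsetSum _ fun i _ => hi4 i]
    have e2 : ∀ i, ∫ D', (2 * g D (D' i) - q D (D' i) - 2 * g D (D i)) ∂π =
        ∫ z, q D z ∂ρ - 2 * g D (D i) := by
      intro i
      rw [integral_sub (hi3 i) (integrable_const _), integral_sub (hi1 i) (hi2 i),
        integral_const_mul]
      have e3 : ∫ D', g D (D' i) ∂π = ∫ z, g D z ∂ρ :=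
        integral_comp_eval (μ := fun _ : Fin n => ρ) (f := g D) hgD.aestronglyMeasurable
      have e4 : ∫ D', q D (D' i) ∂π = ∫ z, q D z ∂ρ :=
        integral_comp_eval (μ := fun _ : Fin n => ρ) (f := q D) hqD.aestronglyMeasurable
      rw [e3, e4, hPg D]
      simp
      ring
    simp_rw [e2]
    rw [Finset.sum_sub_distrib, ← Finset.mul_sum]
    simp
  have hΦi : Integrable Φ (π.prod π) := Integrable.of_bound hΦm.aestronglyMeasurable _
      (Filter.Eventually.of_forall hΦB)
  rw [integral_prod _ hΦi] at hswap
  simp_rw [hD1] at hswap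
  have hsum : Measurable fun D : Fin n → Z => ∑ i, g D (D i) :=
    Finset.measurable_fun_sum _ fun i _ =>
      hgm.comp (measurable_id.prodMk (measurable_pi_apply i))
  have hsumB : ∀ D : Fin n → Z, |∑ i, g D (D i)| ≤ n * B := by
    intro D
    refine (Finset.abs_sum_le_sum_abs _ _).trans ?_
    exact (Finset.sum_le_card_nsmul _ _ B fun i _ => hgB D _).trans (by simp)
  have herr : Integrable (fun D : Fin n → Z => ∫ z, q D z ∂ρ) π := by
    refine int_of _ B hqm.stronglyMeasurable.integral_prod_right'.measurable fun D => ?_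
    have := norm_integral_le_of_norm_le_const (μ := ρ) (f := q D) (C := B)
      (Filter.Eventually.of_forall (hqB D))
    simpa using this
  rw [integral_sub (herr.const_mul _) ((int_of _ _ hsum hsumB).const_mul 2),
    integral_const_mul, integral_const_mul] at hswap
  linarith

end Symmetrisation

/-! ### Excess risk of truncated least squares. -/

section LeastSquares

open ProbabilityTheory

variable {𝒳 𝒴 : Type*} [MeasurableSpace 𝒳] [MeasurableSpace 𝒴]

/-- The mean of a label `v` under a transition kernel. -/
noncomputable def kernelMean (κ : Kernel 𝒳 𝒴) (v : 𝒴 → ℝ) (x : 𝒳) : ℝ := ∫ y, v y ∂κ x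

lemma measurable_kernelMean (κ : Kernel 𝒳 𝒴) {v : 𝒴 → ℝ} (hv : Measurable v) :
    Measurable (kernelMean κ v) :=
  hv.stronglyMeasurable.integral_kernel.measurable

lemma abs_kernelMean_le (κ : Kernel 𝒳 𝒴) [IsMarkovKernel κ] {v : 𝒴 → ℝ} {L : ℝ}
    (hvL : ∀ y, |v y| ≤ L) (x : 𝒳) : |kernelMean κ v x| ≤ L := by
  have := norm_integral_le_of_norm_le_const (μ := κ x) (f := v) (C := L)
    (Filter.Eventually.of_forall hvL)
  simpa [kernelMean] using this

variable (μ : Measure 𝒳) [IsProbabilityMeasure μ] (κ : Kernel 𝒳 𝒴) [IsMarkovKernel κ]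

lemma measurePreserving_fst_compProd : MeasurePreserving Prod.fst (μ ⊗ₘ κ) μ :=
  ⟨measurable_fst, Measure.fst_compProd μ κ⟩

variable {v : 𝒴 → ℝ} {L : ℝ}

lemma integrable_mul_residual (hv : Measurable v) (hvL : ∀ y, |v y| ≤ L) {f : 𝒳 → ℝ}
    (hf : Integrable f μ) :
    Integrable (fun z : 𝒳 × 𝒴 => f z.1 * (kernelMean κ v z.1 - v z.2)) (μ ⊗ₘ κ) := by
  refine Integrable.mul_bdd (c := L + L)
    ((measurePreserving_fst_compProd μ κ).integrable_comp_of_integrable hf) ?_ ?_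
  · have := measurable_kernelMean κ hv
    exact (by fun_prop : Measurable fun z : 𝒳 × 𝒴 =>
      kernelMean κ v z.1 - v z.2).aestronglyMeasurable
  · refine Filter.Eventually.of_forall fun z => ?_
    exact (norm_sub_le _ _).trans (add_le_add (abs_kernelMean_le κ hvL _) (hvL _))

/-- Orthogonality of the residual: it has conditional mean zero given the first coordinate. -/
lemma integral_mul_residual (hv : Measurable v) (hvL : ∀ y, |v y| ≤ L) {f : 𝒳 → ℝ}
    (hf : Integrable f μ) :
    ∫ z, f z.1 * (kernelMean κ v z.1 - v z.2) ∂(μ ⊗ₘ κ) = 0 := by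
  rw [Measure.integral_compProd (integrable_mul_residual μ κ hv hvL hf)]
  refine integral_eq_zero_of_ae (Filter.Eventually.of_forall fun x => ?_)
  have hvi : Integrable v (κ x) := Integrable.of_bound hv.aestronglyMeasurable L
    (Filter.Eventually.of_forall hvL)
  simp only [integral_const_mul]
  rw [integral_sub (integrable_const _) hvi]
  simp [kernelMean]

/-- Pythagoras: the cross term in the expansion around the regression function is killed by the
preceding orthogonality. Only the difference of the squares is integrated, and `f` need not be
bounded, since it is later an arbitrary competitor `w`. -/
lemma integral_excess (hv : Measurable v) (hvL : ∀ y, |v y| ≤ L) {f : 𝒳 → ℝ}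
    (hf : MemLp (fun x => f x - kernelMean κ v x) 2 μ) :
    Integrable (fun z : 𝒳 × 𝒴 => (f z.1 - v z.2) ^ 2 - (kernelMean κ v z.1 - v z.2) ^ 2)
      (μ ⊗ₘ κ) ∧
    ∫ z, ((f z.1 - v z.2) ^ 2 - (kernelMean κ v z.1 - v z.2) ^ 2) ∂(μ ⊗ₘ κ) =
      ∫ x, (f x - kernelMean κ v x) ^ 2 ∂μ := by
  have e : (fun z : 𝒳 × 𝒴 => (f z.1 - v z.2) ^ 2 - (kernelMean κ v z.1 - v z.2) ^ 2) =
      fun z => (f z.1 - kernelMean κ v z.1) ^ 2 +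
        2 * ((f z.1 - kernelMean κ v z.1) * (kernelMean κ v z.1 - v z.2)) := by
    funext z; ring
  have hfi : Integrable (fun x => f x - kernelMean κ v x) μ := hf.integrable (by norm_num)
  have h1 : Integrable (fun z : 𝒳 × 𝒴 => (f z.1 - kernelMean κ v z.1) ^ 2) (μ ⊗ₘ κ) :=
    (measurePreserving_fst_compProd μ κ).integrable_comp_of_integrable hf.integrable_sq
  have h2 := (integrable_mul_residual μ κ hv hvL hfi).const_mul 2
  rw [e]
  refine ⟨h1.add h2, ?_⟩
  rw [integral_add h1 h2, integral_const_mul, integral_mul_residual μ κ hv hvL hfi, mul_zero,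
    add_zero]
  have h3 : AEStronglyMeasurable (fun x => (f x - kernelMean κ v x) ^ 2)
      ((μ ⊗ₘ κ).map Prod.fst) := by
    rw [(measurePreserving_fst_compProd μ κ).map_eq]
    exact hf.integrable_sq.aestronglyMeasurable
  conv_rhs => rw [← (measurePreserving_fst_compProd μ κ).map_eq]
  rw [integral_map measurable_fst.aemeasurable h3]

variable {n : ℕ} {est : (Fin n → 𝒳 × 𝒴) → 𝒳 → ℝ}

/-- The expected squared error of a truncated estimate with values in a class of finite
Vapnik–Chervonenkis dimension is at most twice its expected empirical excess risk, up to a term of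
order `log n / n`. -/
lemma integral_sq_error_le_empirical {Ψ : Set (𝒳 → ℝ)} {V : ℕ} (hV : vcDim Ψ ≤ V) (hL : 0 < L)
    (hn : 1 ≤ n) (hv : Measurable v) (hvL : ∀ y, |v y| ≤ L)
    (hest : Measurable fun p : (Fin n → 𝒳 × 𝒴) × 𝒳 => est p.1 p.2) (hmem : ∀ D, est D ∈ Ψ) :
    n * ∫ D, ∫ x, (truncate L (est D x) - kernelMean κ v x) ^ 2 ∂μ
        ∂(Measure.pi fun _ : Fin n => μ ⊗ₘ κ) ≤
      2 * ∫ D, ∑ i, ((truncate L (est D (D i).1) - v (D i).2) ^ 2 -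
          (kernelMean κ v (D i).1 - v (D i).2) ^ 2) ∂(Measure.pi fun _ : Fin n => μ ⊗ₘ κ) +
      (162 * L ^ 2 * (V * Real.log (2 * n * (n + 1) + 1)) + 48 * L ^ 2) := by
  have ht := measurable_kernelMean κ hv
  have htL := abs_kernelMean_le κ hvL
  have hT := abs_truncate_le hL.le
  have hTest : Measurable fun p : (Fin n → 𝒳 × 𝒴) × 𝒳 => truncate L (est p.1 p.2) :=
    (measurable_truncate hL.le).comp hest
  have hTz : Measurable fun p : (Fin n → 𝒳 × 𝒴) × (𝒳 × 𝒴) => truncate L (est p.1 p.2.1) :=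
    hTest.comp (measurable_fst.prodMk (measurable_fst.comp measurable_snd))
  have hqB : ∀ (D : Fin n → 𝒳 × 𝒴) (z : 𝒳 × 𝒴),
      |(truncate L (est D z.1) - kernelMean κ v z.1) ^ 2| ≤ 4 * L ^ 2 := by
    intro D z
    rw [abs_of_nonneg (sq_nonneg _), show 4 * L ^ 2 = (2 * L) ^ 2 by ring]
    have h1 := abs_le.1 (hT (est D z.1))
    have h2 := abs_le.1 (htL z.1)
    exact sq_le_sq' (by linarith) (by linarith)
  have hhB : ∀ (D : Fin n → 𝒳 × 𝒴) (z : 𝒳 × 𝒴),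
      |contrast (truncate L (est D z.1)) (v z.2) (kernelMean κ v z.1)| ≤ 18 * L ^ 2 :=
    fun D z => abs_contrast_le (hT _) (hvL _) (htL _)
  have hghq : ∀ (D : Fin n → 𝒳 × 𝒴) (z : 𝒳 × 𝒴),
      2 * ((truncate L (est D z.1) - v z.2) ^ 2 - (kernelMean κ v z.1 - v z.2) ^ 2) =
        contrast (truncate L (est D z.1)) (v z.2) (kernelMean κ v z.1) +
          (truncate L (est D z.1) - kernelMean κ v z.1) ^ 2 / 2 := fun D z => by
    simp only [contrast]; ring
  have hDm : ∀ D, Measurable fun x => truncate L (est D x) - kernelMean κ v x := fun D =>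
    (hTest.comp (measurable_prodMk_left (x := D))).sub ht
  have hq : ∀ D, ∫ z, (truncate L (est D z.1) - kernelMean κ v z.1) ^ 2 ∂(μ ⊗ₘ κ) =
      ∫ x, (truncate L (est D x) - kernelMean κ v x) ^ 2 ∂μ := by
    intro D
    conv_rhs => rw [← (measurePreserving_fst_compProd μ κ).map_eq]
    rw [integral_map measurable_fst.aemeasurable ((hDm D).pow_const 2).aestronglyMeasurable]
  have hPg : ∀ D, ∫ z, ((truncate L (est D z.1) - v z.2) ^ 2 -
        (kernelMean κ v z.1 - v z.2) ^ 2) ∂(μ ⊗ₘ κ) =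
      ∫ z, (truncate L (est D z.1) - kernelMean κ v z.1) ^ 2 ∂(μ ⊗ₘ κ) := by
    intro D
    have hL2 : MemLp (fun x => truncate L (est D x) - kernelMean κ v x) 2 μ :=
      MemLp.of_bound (hDm D).aestronglyMeasurable (L + L) (Filter.Eventually.of_forall fun x =>
        (norm_sub_le _ _).trans (add_le_add (hT _) (htL _)))
    exact (integral_excess μ κ hv hvL hL2).2.trans (hq D).symm
  have hmain := integral_integral_le_of_swap (n := n) (μ ⊗ₘ κ)
    (h := fun D z => contrast (truncate L (est D z.1)) (v z.2) (kernelMean κ v z.1))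
    (q := fun D z => (truncate L (est D z.1) - kernelMean κ v z.1) ^ 2)
    (g := fun D z => (truncate L (est D z.1) - v z.2) ^ 2 - (kernelMean κ v z.1 - v z.2) ^ 2)
    (B := 18 * L ^ 2) (by simp only [contrast]; fun_prop) (by fun_prop) (by fun_prop) hhB
    (fun D z => (hqB D z).trans (by nlinarith))
    (fun D z => by
      have h1 := abs_le.1 (hhB D z)
      have h2 := abs_le.1 (hqB D z)
      rw [abs_le]
      constructor <;> nlinarith [hghq D z])
    hghq hPg
    (C := 162 * L ^ 2 * (V * Real.log (2 * n * (n + 1) + 1)) + 48 * L ^ 2) (by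
      intro p
      have := sum_swapSign_contrast_le hV hL hn (fun i => (p.1 i).1) (fun i => (p.2 i).1)
        (fun i => v (p.1 i).2) (fun i => v (p.2 i).2) (fun i => kernelMean κ v (p.1 i).1)
        (fun i => kernelMean κ v (p.2 i).1) (fun _ => hvL _) (fun _ => hvL _) (fun _ => htL _)
        (fun _ => htL _) (fun σ => est (swapPair σ p).1) (fun σ => hmem _)
      refine le_trans (le_of_eq ?_) this
      refine Finset.sum_congr rfl fun σ _ => Finset.sum_congr rfl fun i _ => ?_
      -- The estimate depends on the swap through the swapped sample; the sign bound allows this, as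
      -- its function may vary arbitrarily with `σ`. What remains is a case check for each
      -- coordinate.
      generalize est (swapPair σ p).1 = E
      rcases hb : σ i <;> simp only [swapPair, swapSign, hb, if_true, Bool.false_eq_true, if_false]
        <;> ring)
  simp_rw [hq] at hmain
  exact hmain

end LeastSquares

/-! ### The risk bound with explicit constants. -/

section RegressionBound

open ProbabilityTheory

lemma log_grid_card_le {n : ℕ} (hn : 1 ≤ n) :
    Real.log (2 * n * (n + 1) + 1) ≤ 2 * (1 + Real.log n) := by
  have hn' : (1 : ℝ) ≤ n := by exact_mod_cast hn
  have h5 : (5 : ℝ) ≤ Real.exp 2 := by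
    have := Real.exp_one_gt_d9
    rw [show (2 : ℝ) = 1 + 1 by norm_num, Real.exp_add]
    nlinarith
  rw [Real.log_le_iff_le_exp (by positivity),
    show 2 * (1 + Real.log n) = 2 + (Real.log n + Real.log n) by ring, Real.exp_add, Real.exp_add,
    Real.exp_log (by positivity)]
  have : (5 : ℝ) * (n * n) ≤ Real.exp 2 * (n * n) := by gcongr
  nlinarith

variable {𝒳 𝒴 : Type*} [MeasurableSpace 𝒳] [MeasurableSpace 𝒴]
variable (μ : Measure 𝒳) [IsProbabilityMeasure μ] (κ : Kernel 𝒳 𝒴) [IsMarkovKernel κ]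
variable {v : 𝒴 → ℝ} {L : ℝ} {n : ℕ} {est : (Fin n → 𝒳 × 𝒴) → 𝒳 → ℝ}

/-- Truncation towards an interval containing the labels only lowers the empirical loss, and the
minimiser beats the fixed competitor `w`, whose expected excess is its squared distance to the
regression function. -/
lemma integral_empirical_excess_le {w : 𝒳 → ℝ} (hL : 0 < L) (hv : Measurable v)
    (hvL : ∀ y, |v y| ≤ L)
    (hest : Measurable fun p : (Fin n → 𝒳 × 𝒴) × 𝒳 => est p.1 p.2)
    (hmin : ∀ D, ∑ i, |v (D i).2 - est D (D i).1| ^ 2 ≤ ∑ i, |v (D i).2 - w (D i).1| ^ 2)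
    (hw2 : MemLp (fun x => w x - kernelMean κ v x) 2 μ) :
    ∫ D, ∑ i, ((truncate L (est D (D i).1) - v (D i).2) ^ 2 -
        (kernelMean κ v (D i).1 - v (D i).2) ^ 2) ∂(Measure.pi fun _ : Fin n => μ ⊗ₘ κ) ≤
      n * ∫ x, (w x - kernelMean κ v x) ^ 2 ∂μ := by
  obtain ⟨hr, hr'⟩ := integral_excess μ κ hv hvL hw2
  have ht := measurable_kernelMean κ hv
  have hri : ∀ i : Fin n, Integrable (fun D : Fin n → 𝒳 × 𝒴 =>
      (w (D i).1 - v (D i).2) ^ 2 - (kernelMean κ v (D i).1 - v (D i).2) ^ 2)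
      (Measure.pi fun _ : Fin n => μ ⊗ₘ κ) := fun i =>
    integrable_comp_eval (μ := fun _ : Fin n => μ ⊗ₘ κ) (i := i) hr
  have hTest : Measurable fun p : (Fin n → 𝒳 × 𝒴) × 𝒳 => truncate L (est p.1 p.2) :=
    (measurable_truncate hL.le).comp hest
  have hTi : ∀ i : Fin n, Measurable fun D : Fin n → 𝒳 × 𝒴 => truncate L (est D (D i).1) :=
    fun i => hTest.comp (measurable_id.prodMk (measurable_fst.comp (measurable_pi_apply i)))
  have hTb := abs_truncate_le hL.le
  have hli : ∀ i : Fin n, Integrable (fun D : Fin n → 𝒳 × 𝒴 =>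
      (truncate L (est D (D i).1) - v (D i).2) ^ 2 - (kernelMean κ v (D i).1 - v (D i).2) ^ 2)
      (Measure.pi fun _ : Fin n => μ ⊗ₘ κ) := by
    intro i
    have := hTi i
    refine Integrable.of_bound
      (Measurable.aestronglyMeasurable (by fun_prop)) (4 * L ^ 2)
      (Filter.Eventually.of_forall fun D => ?_)
    have h1 := abs_le.1 (hTb (est D (D i).1))
    have h2 := abs_le.1 (hvL (D i).2)
    have h3 := abs_le.1 (abs_kernelMean_le κ hvL (D i).1)
    have h4 : (truncate L (est D (D i).1) - v (D i).2) ^ 2 ≤ (2 * L) ^ 2 :=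
      sq_le_sq' (by linarith) (by linarith)
    have h5 : (kernelMean κ v (D i).1 - v (D i).2) ^ 2 ≤ (2 * L) ^ 2 :=
      sq_le_sq' (by linarith) (by linarith)
    rw [Real.norm_eq_abs, abs_le]
    constructor <;>
      nlinarith [sq_nonneg (truncate L (est D (D i).1) - v (D i).2),
        sq_nonneg (kernelMean κ v (D i).1 - v (D i).2)]
  calc _ ≤ ∫ D, ∑ i, ((w (D i).1 - v (D i).2) ^ 2 - (kernelMean κ v (D i).1 - v (D i).2) ^ 2)
        ∂(Measure.pi fun _ : Fin n => μ ⊗ₘ κ) := by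
        refine integral_mono (integrable_finsetSum _ fun i _ => hli i)
          (integrable_finsetSum _ fun i _ => hri i) fun D => ?_
        simp only [Finset.sum_sub_distrib]
        refine sub_le_sub_right ?_ _
        calc ∑ i, (truncate L (est D (D i).1) - v (D i).2) ^ 2
            ≤ ∑ i, |v (D i).2 - est D (D i).1| ^ 2 := by
              refine Finset.sum_le_sum fun i _ => ?_
              rw [abs_sub_comm, sq_abs]
              exact sq_le_sq.2 (abs_truncate_sub_le (hvL _))
          _ ≤ ∑ i, |v (D i).2 - w (D i).1| ^ 2 := hmin D
          _ = _ := by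
              refine Finset.sum_congr rfl fun i _ => ?_
              rw [abs_sub_comm, sq_abs]
    _ = ∑ i : Fin n, ∫ x, (w x - kernelMean κ v x) ^ 2 ∂μ := by
        rw [integral_finsetSum _ fun i _ => hri i]
        refine Finset.sum_congr rfl fun i _ => ?_
        rw [← hr']
        exact integral_comp_eval (μ := fun _ : Fin n => μ ⊗ₘ κ) (i := i) hr.aestronglyMeasurable
    _ = _ := by simp

/-- Risk bound for truncated least squares over a class of finite Vapnik–Chervonenkis
dimension. -/
theorem lintegral_sq_error_le {Ψ : Set (𝒳 → ℝ)} {V : ℕ} (hV : vcDim Ψ = V) (hL : 0 < L)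
    (hn : 1 ≤ n) (hv : Measurable v) (hvL : ∀ y, |v y| ≤ L)
    (hest : Measurable fun p : (Fin n → 𝒳 × 𝒴) × 𝒳 => est p.1 p.2) (hmem : ∀ D, est D ∈ Ψ)
    {w : 𝒳 → ℝ} (hwΨ : w ∈ Ψ) (hw : Measurable w)
    (hmin : ∀ D, ∑ i, |v (D i).2 - est D (D i).1| ^ 2 ≤ ∑ i, |v (D i).2 - w (D i).1| ^ 2) :
    ∫⁻ D, ∫⁻ x, ENNReal.ofReal ((truncate L (est D x) - kernelMean κ v x) ^ 2) ∂μ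
        ∂(Measure.pi fun _ : Fin n => μ ⊗ₘ κ) ≤
      ENNReal.ofReal (372 * L ^ 2 * ((1 + Real.log n) / n)) * V +
        2 * ∫⁻ x, ENNReal.ofReal ((kernelMean κ v x - w x) ^ 2) ∂μ := by
  have ht := measurable_kernelMean κ hv
  have htL := abs_kernelMean_le κ hvL
  have hT := abs_truncate_le hL.le
  have hsymm : ∀ x, (kernelMean κ v x - w x) ^ 2 = (w x - kernelMean κ v x) ^ 2 := fun x => by ring
  simp_rw [hsymm]
  -- The case `V = 0` is separate because the discretisation term `48 * L ^ 2` does not vanish with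
  -- `V`. The class then consists of `w` alone and there is no stochastic error.
  rcases Nat.eq_zero_or_pos V with rfl | hV1
  · have hsub := subsingleton_of_vcDim_eq_zero (Ψ := Ψ) (by simpa using hV)
    have he : ∀ D, est D = w := fun D => hsub (hmem D) hwΨ
    simp_rw [he]
    rw [lintegral_const, measure_univ, mul_one]
    refine le_trans ?_ (le_trans (le_mul_of_one_le_left (zero_le) one_le_two) le_add_self)
    exact lintegral_mono fun x => ENNReal.ofReal_le_ofReal (sq_le_sq.2 (abs_truncate_sub_le (htL x)))
  by_cases hw2 : MemLp (fun x => w x - kernelMean κ v x) 2 μ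
  swap
  · have htop : ∫⁻ x, ENNReal.ofReal ((w x - kernelMean κ v x) ^ 2) ∂μ = ⊤ := by
      by_contra hne
      apply hw2
      refine (memLp_two_iff_integrable_sq (f := fun x => w x - kernelMean κ v x)
        (hw.sub ht).aestronglyMeasurable).2 ?_
      exact (lintegral_ofReal_ne_top_iff_integrable
        (((hw.sub ht).pow_const 2).aestronglyMeasurable)
        (Filter.Eventually.of_forall fun x => sq_nonneg _)).1 hne
    rw [htop]
    simp
  have hn' : (0 : ℝ) < n := by exact_mod_cast hn
  have h1 := integral_sq_error_le_empirical μ κ hV.le hL hn hv hvL hest hmem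
  have h2 := integral_empirical_excess_le μ κ hL hv hvL hest hmin hw2
  set π := Measure.pi fun _ : Fin n => μ ⊗ₘ κ
  have hTest : Measurable fun p : (Fin n → 𝒳 × 𝒴) × 𝒳 => truncate L (est p.1 p.2) :=
    (measurable_truncate hL.le).comp hest
  have hsm : Measurable fun p : (Fin n → 𝒳 × 𝒴) × 𝒳 =>
      (truncate L (est p.1 p.2) - kernelMean κ v p.2) ^ 2 := by fun_prop
  have hsB : ∀ D x, ‖(truncate L (est D x) - kernelMean κ v x) ^ 2‖ ≤ 4 * L ^ 2 := by
    intro D x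
    rw [Real.norm_of_nonneg (sq_nonneg _), show 4 * L ^ 2 = (2 * L) ^ 2 by ring]
    have h1 := abs_le.1 (hT (est D x))
    have h2 := abs_le.1 (htL x)
    exact sq_le_sq' (by linarith) (by linarith)
  have hi1 : ∀ D, Integrable (fun x => (truncate L (est D x) - kernelMean κ v x) ^ 2) μ := fun D =>
    Integrable.of_bound (hsm.comp (measurable_prodMk_left (x := D))).aestronglyMeasurable _
      (Filter.Eventually.of_forall (hsB D))
  have hi2 : Integrable (fun D => ∫ x, (truncate L (est D x) - kernelMean κ v x) ^ 2 ∂μ) π := by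
    refine Integrable.of_bound
      hsm.stronglyMeasurable.integral_prod_right'.aestronglyMeasurable (4 * L ^ 2)
      (Filter.Eventually.of_forall fun D => ?_)
    simpa using norm_integral_le_of_norm_le_const (μ := μ) (Filter.Eventually.of_forall (hsB D))
  have e1 : ∀ D, ∫⁻ x, ENNReal.ofReal ((truncate L (est D x) - kernelMean κ v x) ^ 2) ∂μ =
      ENNReal.ofReal (∫ x, (truncate L (est D x) - kernelMean κ v x) ^ 2 ∂μ) := fun D =>
    (ofReal_integral_eq_lintegral_ofReal (hi1 D)
      (Filter.Eventually.of_forall fun x => sq_nonneg _)).symm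
  simp_rw [e1]
  rw [← ofReal_integral_eq_lintegral_ofReal hi2
      (Filter.Eventually.of_forall fun D => integral_nonneg fun x => sq_nonneg _),
    ← ofReal_integral_eq_lintegral_ofReal hw2.integrable_sq
      (Filter.Eventually.of_forall fun x => sq_nonneg _)]
  have hlogn : 0 ≤ Real.log n := Real.log_nonneg (by exact_mod_cast hn)
  have hI : 0 ≤ ∫ x, (w x - kernelMean κ v x) ^ 2 ∂μ := integral_nonneg fun x => sq_nonneg _
  have eV : (V : ENNReal) = ENNReal.ofReal V := (ENNReal.ofReal_natCast V).symm
  have e2 : (2 : ENNReal) = ENNReal.ofReal 2 := by simp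
  rw [eV, e2, ← ENNReal.ofReal_mul (by positivity), ← ENNReal.ofReal_mul (by norm_num),
    ← ENNReal.ofReal_add (by positivity) (by positivity)]
  refine ENNReal.ofReal_le_ofReal ?_
  have hVr : (1 : ℝ) ≤ V := by exact_mod_cast hV1
  -- The constant is `372 = 2 * 162 + 48`; the discretisation term is absorbed by means of `V ≥ 1`.
  have h3 : 162 * L ^ 2 * (V * Real.log (2 * n * (n + 1) + 1)) + 48 * L ^ 2 ≤
      372 * L ^ 2 * (1 + Real.log n) * V := by
    have ha : 162 * L ^ 2 * (V * Real.log (2 * n * (n + 1) + 1)) ≤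
        162 * L ^ 2 * (V * (2 * (1 + Real.log n))) := by
      gcongr; exact log_grid_card_le hn
    have hb : 48 * L ^ 2 * (1 * 1) ≤ 48 * L ^ 2 * ((1 + Real.log n) * V) := by
      gcongr; linarith
    linarith
  have h4 : (n : ℝ) * ∫ D, ∫ x, (truncate L (est D x) - kernelMean κ v x) ^ 2 ∂μ ∂π ≤
      n * (372 * L ^ 2 * ((1 + Real.log n) / n) * V +
        2 * ∫ x, (w x - kernelMean κ v x) ^ 2 ∂μ) := by
    have e : (n : ℝ) * (372 * L ^ 2 * ((1 + Real.log n) / n) * V +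
        2 * ∫ x, (w x - kernelMean κ v x) ^ 2 ∂μ) = 372 * L ^ 2 * (1 + Real.log n) * V +
        2 * (n * ∫ x, (w x - kernelMean κ v x) ^ 2 ∂μ) := by field_simp
    rw [e]
    linarith
  exact le_of_mul_le_mul_left h4 hn'

end RegressionBound

/-! ### Suprema over finite, state-dependent action sets. -/

section FiniteSup

variable {α 𝓚 : Type*} [Finite 𝓚] {K : α → Set 𝓚} {F : 𝓚 → α → ℝ}

lemma le_iSup_of_mem {s : Set 𝓚} (f : 𝓚 → ℝ) {a : 𝓚} (ha : a ∈ s) : f a ≤ ⨆ b : s, f b :=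
  le_ciSup (f := fun b : s => f b) (Set.finite_range _).bddAbove ⟨a, ha⟩

lemma exists_mem_eq_iSup {s : Set 𝓚} (hs : s.Nonempty) (f : 𝓚 → ℝ) :
    ∃ a ∈ s, f a = ⨆ b : s, f b := by
  have := hs.to_subtype
  obtain ⟨a, ha⟩ := exists_eq_ciSup_of_finite (f := fun b : s => f b)
  exact ⟨a, a.2, ha⟩

lemma abs_iSup_sub_iSup_le {s : Set 𝓚} (hs : s.Nonempty) {f g : 𝓚 → ℝ} {B : ℝ}
    (h : ∀ a ∈ s, |f a - g a| ≤ B) : |(⨆ b : s, f b) - ⨆ b : s, g b| ≤ B := by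
  obtain ⟨a, ha, hfa⟩ := exists_mem_eq_iSup hs f
  obtain ⟨b, hb, hgb⟩ := exists_mem_eq_iSup hs g
  have h1 := abs_le.1 (h a ha)
  have h2 := abs_le.1 (h b hb)
  have h3 := le_iSup_of_mem g ha
  have h4 := le_iSup_of_mem f hb
  rw [abs_le]
  constructor <;> linarith

lemma abs_iSup_le {s : Set 𝓚} (hs : s.Nonempty) {f : 𝓚 → ℝ} {B : ℝ}
    (h : ∀ a ∈ s, |f a| ≤ B) : |⨆ b : s, f b| ≤ B := by
  obtain ⟨a, ha, hfa⟩ := exists_mem_eq_iSup hs f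
  rw [← hfa]
  exact h a ha

variable [MeasurableSpace α]

lemma measurable_iSup_set (hK : ∀ a, MeasurableSet {x | a ∈ K x}) (hne : ∀ x, (K x).Nonempty)
    (hF : ∀ a, Measurable (F a)) : Measurable fun x => ⨆ a : K x, F a x := by
  refine measurable_of_Ici fun c => ?_
  have e : (fun x => ⨆ a : K x, F a x) ⁻¹' Set.Ici c =
      ⋃ a, ({x | a ∈ K x} ∩ F a ⁻¹' Set.Ici c) := by
    ext x
    simp only [Set.mem_preimage, Set.mem_Ici, Set.mem_iUnion, Set.mem_inter_iff, Set.mem_ofPred_eq]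
    constructor
    · intro h
      obtain ⟨a, ha, hfa⟩ := exists_mem_eq_iSup (hne x) fun a => F a x
      exact ⟨a, ha, by rwa [hfa]⟩
    · rintro ⟨a, ha, h⟩
      exact h.trans (le_iSup_of_mem (fun a => F a x) ha)
  rw [e]
  exact MeasurableSet.iUnion fun a => (hK a).inter (hF a measurableSet_Ici)

/-- The set of maximisers takes finitely many values, on measurable sets. Fixing beforehand one
element of each nonempty subset of `𝓚` makes the selection measurable. -/
lemma exists_measurable_maximiser [Nonempty 𝓚] (hK : ∀ a, MeasurableSet {x | a ∈ K x})
    (hne : ∀ x, (K x).Nonempty) (hF : ∀ a, Measurable (F a)) :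
    ∃ sel : α → 𝓚, (∀ a, MeasurableSet {x | sel x = a}) ∧
      ∀ x, sel x ∈ K x ∧ F (sel x) x = ⨆ a : K x, F a x := by
  have hc : ∀ s : Set 𝓚, ∃ a, s.Nonempty → a ∈ s := fun s => by
    by_cases h : s.Nonempty
    · exact ⟨h.some, fun _ => h.some_mem⟩
    · exact ⟨Classical.arbitrary 𝓚, fun h' => absurd h' h⟩
  choose c hc using hc
  let T : α → Set 𝓚 := fun x => {a | a ∈ K x ∧ F a x = ⨆ b : K x, F b x}
  have hT : ∀ x, c (T x) ∈ T x := fun x => hc _ (exists_mem_eq_iSup (hne x) fun a => F a x)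
  have hTm : ∀ a, MeasurableSet {x | a ∈ T x} := fun a =>
    (hK a).inter (measurableSet_eq_fun (hF a) (measurable_iSup_set hK hne hF))
  have hTs : ∀ s, MeasurableSet {x | T x = s} := by
    intro s
    have e : {x | T x = s} = ⋂ a, {x | a ∈ T x ↔ a ∈ s} := by
      ext x; simp [Set.ext_iff]
    rw [e]
    exact MeasurableSet.iInter fun a => (hTm a).iff (MeasurableSet.const _)
  refine ⟨fun x => c (T x), fun a => ?_, hT⟩
  have e : {x | c (T x) = a} = ⋃ s ∈ {s : Set 𝓚 | c s = a}, {x | T x = s} := by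
    ext x; simp
  rw [e]
  exact MeasurableSet.biUnion (Set.to_countable _) fun s _ => hTs s

end FiniteSup

/-! ### Transition kernels and the Markov property. -/

section Transition

open ProbabilityTheory

variable {Ω 𝒳 𝓛 : Type*} [MeasurableSpace Ω] [MeasurableSpace 𝒳] (m : MarkovModel Ω 𝒳)

lemma MarkovModel.measurable_X {j : ℕ} (hj : j ≤ m.J) : Measurable (m.X j) :=
  (m.adapted j hj).mono (m.ℱ.le j) le_rfl

/-- The one-step transition kernel of the process from time `j` to time `j + 1`. -/
noncomputable def MarkovModel.transition (j : ℕ) : Kernel 𝒳 𝒳 :=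
  if h : j < m.J then
    ⟨fun x => (m.Pc j x).map (m.X (j + 1)), by
      refine Measure.measurable_of_measurable_coe _ fun B hB => ?_
      simp_rw [Measure.map_apply (m.measurable_X h) hB]
      exact m.measurable_transition j h B hB⟩
  else Kernel.id

lemma MarkovModel.transition_apply {j : ℕ} (hj : j < m.J) (x : 𝒳) :
    m.transition j x = (m.Pc j x).map (m.X (j + 1)) := by
  rw [MarkovModel.transition, dif_pos hj]
  rfl

instance (j : ℕ) : IsMarkovKernel (m.transition j) := by
  by_cases h : j < m.J
  · refine ⟨fun x => ?_⟩
    rw [m.transition_apply h]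
    have := m.prob_cond j h.le x
    exact Measure.isProbabilityMeasure_map (m.measurable_X h).aemeasurable
  · rw [MarkovModel.transition, dif_neg h]
    infer_instance

lemma MarkovModel.kernelMean_transition {j : ℕ} (hj : j < m.J) {f : 𝒳 → ℝ} (hf : Measurable f)
    (x : 𝒳) : kernelMean (m.transition j) f x = ∫ ω, f (m.X (j + 1) ω) ∂(m.Pc j x) := by
  rw [kernelMean, m.transition_apply hj,
    integral_map (m.measurable_X hj).aemeasurable hf.aestronglyMeasurable]

/-- The Markov property of the process at time `l` under a measure `Q`. -/
def MarkovModel.IsMarkovAt (Q : Measure Ω) (l : ℕ) : Prop :=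
  ∀ A : Set Ω, MeasurableSet[m.ℱ l] A → ∀ B : Set 𝒳, MeasurableSet B →
    Q (A ∩ m.X (l + 1) ⁻¹' B) = ∫⁻ ω in A, m.Pc l (m.X l ω) (m.X (l + 1) ⁻¹' B) ∂Q

variable {m} {Q : Measure Ω} {l : ℕ}

/-- Used to freeze the control: on each event `Z = z` known at time `l`, the Markov property still
holds and the control is constant. -/
lemma MarkovModel.IsMarkovAt.restrict (hQ : m.IsMarkovAt Q l) (hl : l < m.J) {A : Set Ω}
    (hA : MeasurableSet[m.ℱ l] A) : m.IsMarkovAt (Q.restrict A) l := by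
  intro A' hA' B hB
  have hA0 : MeasurableSet A := m.ℱ.le l A hA
  have hA'0 : MeasurableSet A' := m.ℱ.le l A' hA'
  rw [Measure.restrict_restrict hA'0, ← hQ _ (hA'.inter hA) B hB,
    Measure.restrict_apply (hA'0.inter (m.measurable_X hl hB)), Set.inter_right_comm]

lemma MarkovModel.IsMarkovAt.map_pair [IsFiniteMeasure Q] (hQ : m.IsMarkovAt Q l)
    (hl : l < m.J) :
    Q.map (fun ω => (m.X l ω, m.X (l + 1) ω)) = Q.map (m.X l) ⊗ₘ m.transition l := by
  have hX := m.measurable_X hl.le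
  have hX' := m.measurable_X hl
  refine Measure.ext_prod fun {s t} hs ht => ?_
  rw [Measure.map_apply (hX.prodMk hX') (hs.prod ht), Measure.compProd_apply_prod hs ht,
    setLIntegral_map hs ((m.transition l).measurable_coe ht) hX]
  have := hQ (m.X l ⁻¹' s) (m.adapted l hl.le hs) t ht
  simp_rw [m.transition_apply hl, Measure.map_apply hX' ht]
  exact this

lemma MarkovModel.IsMarkovAt.integral_next [IsFiniteMeasure Q] (hQ : m.IsMarkovAt Q l)
    (hl : l < m.J) {f : 𝒳 → ℝ} (hf : Measurable f) {B : ℝ} (hB : ∀ x, |f x| ≤ B) :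
    ∫ ω, f (m.X (l + 1) ω) ∂Q = ∫ ω, kernelMean (m.transition l) f (m.X l ω) ∂Q := by
  have hX := m.measurable_X hl.le
  have hX' := m.measurable_X hl
  have hfs : Measurable fun p : 𝒳 × 𝒳 => f p.2 := hf.comp measurable_snd
  have h1 : ∫ p, f p.2 ∂(Q.map fun ω => (m.X l ω, m.X (l + 1) ω)) =
      ∫ ω, f (m.X (l + 1) ω) ∂Q :=
    integral_map (hX.prodMk hX').aemeasurable hfs.aestronglyMeasurable
  rw [← h1, hQ.map_pair hl, Measure.integral_compProd, integral_map hX.aemeasurable]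
  · rfl
  · exact (measurable_kernelMean _ hf).aestronglyMeasurable
  · exact Integrable.of_bound hfs.aestronglyMeasurable B
      (Filter.Eventually.of_forall fun p => hB _)

lemma MarkovModel.IsMarkovAt.integral_next_control [Fintype 𝓛] [IsFiniteMeasure Q]
    (hQ : m.IsMarkovAt Q l) (hl : l < m.J) {f : 𝓛 → 𝒳 → ℝ} (hf : ∀ z, Measurable (f z)) {B : ℝ}
    (hB : ∀ z x, |f z x| ≤ B) {Z : Ω → 𝓛} (hZ : ∀ z, MeasurableSet[m.ℱ l] {ω | Z ω = z}) :
    ∫ ω, f (Z ω) (m.X (l + 1) ω) ∂Q =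
      ∫ ω, kernelMean (m.transition l) (f (Z ω)) (m.X l ω) ∂Q := by
  classical
  have split : ∀ (g : 𝓛 → Ω → ℝ), (∀ z, Measurable (g z)) → (∀ z ω, |g z ω| ≤ B) →
      ∫ ω, g (Z ω) ω ∂Q = ∑ z, ∫ ω in {ω | Z ω = z}, g z ω ∂Q := by
    intro g hg hgB
    have e : ∀ ω, g (Z ω) ω = ∑ z, {ω | Z ω = z}.indicator (g z) ω := by
      intro ω
      simp [Set.indicator_apply]
    have hZ' : ∀ z, MeasurableSet {ω | Z ω = z} := fun z => m.ℱ.le l _ (hZ z)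
    have hgi : ∀ z, Integrable (g z) Q := fun z => Integrable.of_bound
      (hg z).aestronglyMeasurable B (Filter.Eventually.of_forall (hgB z))
    simp_rw [e]
    rw [integral_finsetSum _ fun z _ => (hgi z).indicator (hZ' z)]
    exact Finset.sum_congr rfl fun z _ => integral_indicator (hZ' z)
  rw [split (fun z ω => f z (m.X (l + 1) ω)) (fun z => (hf z).comp (m.measurable_X hl))
      (fun z ω => hB _ _),
    split (fun z ω => kernelMean (m.transition l) (f z) (m.X l ω))
      (fun z => (measurable_kernelMean _ (hf z)).comp (m.measurable_X hl.le))
      (fun z ω => abs_kernelMean_le _ (hB z) _)]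
  exact Finset.sum_congr rfl fun z _ => (hQ.restrict hl (hZ z)).integral_next hl (hf z) (hB z)

end Transition

/-! ### The dynamic programming principle. -/

section DynamicProgramming

variable {Ω 𝒳 𝓚 𝓛 : Type*} [MeasurableSpace Ω] [MeasurableSpace 𝒳]
variable (m : MarkovModel Ω 𝒳) (d : ControlData 𝒳 𝓚 𝓛)

/-- The solution of the dynamic programming recursion, equal to `0` after the time horizon. -/
noncomputable def dpValue (j : ℕ) : 𝓛 → 𝒳 → ℝ := fun y x =>
  if j ≤ m.J then ⨆ a : d.K j y x,
    (d.H j a y x + kernelMean (m.transition j) (dpValue (j + 1) (d.φ (j + 1) a y)) x)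
  else 0
termination_by m.J + 1 - j

lemma dpValue_of_le {j : ℕ} (hj : j ≤ m.J) (y : 𝓛) (x : 𝒳) :
    dpValue m d j y x = ⨆ a : d.K j y x,
      (d.H j a y x + kernelMean (m.transition j) (dpValue m d (j + 1) (d.φ (j + 1) a y)) x) := by
  rw [dpValue, if_pos hj]

lemma dpValue_of_lt {j : ℕ} (hj : m.J < j) : dpValue m d j = fun _ _ => 0 := by
  funext y x
  rw [dpValue, if_neg hj.not_ge]

lemma kernelMean_dpValue_horizon (y : 𝓛) (x : 𝒳) :
    kernelMean (m.transition m.J) (dpValue m d (m.J + 1) y) x = 0 := by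
  rw [dpValue_of_lt m d (Nat.lt_succ_self _)]
  simp [kernelMean]

lemma dpValue_horizon (y : 𝓛) (x : 𝒳) :
    dpValue m d m.J y x = ⨆ a : d.K m.J y x, d.H m.J a y x := by
  rw [dpValue_of_le m d le_rfl]
  simp_rw [kernelMean_dpValue_horizon, add_zero]

lemma control_self (φ : ℕ → 𝓚 → 𝓛 → 𝓛) (a : ℕ → 𝓚) (j : ℕ) (y : 𝓛) : control φ a j y j = y := by
  simp [control, controlAfter]

lemma control_succ (φ : ℕ → 𝓚 → 𝓛 → 𝓛) (a : ℕ → 𝓚) {j l : ℕ} (y : 𝓛) (hjl : j ≤ l) :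
    control φ a j y (l + 1) = φ (l + 1) (a l) (control φ a j y l) := by
  obtain ⟨n, rfl⟩ := Nat.exists_eq_add_of_le hjl
  simp [control, add_assoc, controlAfter]

variable [Finite 𝓚]

lemma measurable_dpValue (j : ℕ) (y : 𝓛) : Measurable (dpValue m d j y) := by
  obtain ⟨n, hn⟩ : ∃ n, m.J + 1 - j = n := ⟨_, rfl⟩
  induction n generalizing j y with
  | zero => rw [dpValue_of_lt m d (by omega)]; exact measurable_const
  | succ n ih =>
    have e : dpValue m d j y = fun x => ⨆ a : d.K j y x, (d.H j a y x +
        kernelMean (m.transition j) (dpValue m d (j + 1) (d.φ (j + 1) a y)) x) :=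
      funext fun x => dpValue_of_le m d (by omega) y x
    rw [e]
    exact measurable_iSup_set (d.measurable_K j y) (d.nonempty_K j y) (F := fun a x =>
      d.H j a y x + kernelMean (m.transition j) (dpValue m d (j + 1) (d.φ (j + 1) a y)) x)
      fun a => (d.measurable_H j a y).add (measurable_kernelMean _ (ih (j + 1) _ (by omega)))

variable {C : ℝ} (hH : ∀ j ≤ m.J, ∀ a y x, |d.H j a y x| ≤ C)

include hH in
lemma abs_dpValue_le (j : ℕ) (y : 𝓛) (x : 𝒳) :
    |dpValue m d j y x| ≤ (m.J + 1 - j : ℕ) * C := by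
  obtain ⟨n, hn⟩ : ∃ n, m.J + 1 - j = n := ⟨_, rfl⟩
  rw [hn]
  induction n generalizing j y x with
  | zero => rw [dpValue_of_lt m d (by omega)]; simp
  | succ n ih =>
    rw [dpValue_of_le m d (by omega)]
    refine abs_iSup_le (d.nonempty_K j y x) (f := fun a => d.H j a y x +
        kernelMean (m.transition j) (dpValue m d (j + 1) (d.φ (j + 1) a y)) x) fun a _ => ?_
    refine (abs_add_le _ _).trans ?_
    have h1 := abs_kernelMean_le (m.transition j)
      (fun x' => ih (j + 1) (d.φ (j + 1) a y) x' (by omega)) x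
    have h2 := hH j (by omega) a y x
    push_cast
    linarith

variable [Fintype 𝓛] {j : ℕ} {y : 𝓛} {x : 𝒳} {A : ℕ → Ω → 𝓚}

/-- A map into a finite type whose fibres are known at time `l` is measurable after composition
with a measurable function of `X_l`. -/
lemma measurable_comp_finite {β : Type*} [Finite β] {Z : Ω → β}
    (hZ : ∀ z, MeasurableSet {ω | Z ω = z}) {g : β → Ω → ℝ} (hg : ∀ z, Measurable (g z)) :
    Measurable fun ω => g (Z ω) ω := by
  intro s hs
  have e : (fun ω => g (Z ω) ω) ⁻¹' s = ⋃ z, ({ω | Z ω = z} ∩ g z ⁻¹' s) := by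
    ext ω; simp
  rw [e]
  exact MeasurableSet.iUnion fun z => (hZ z).inter (hg z hs)

variable {m d}

lemma measurableSet_control (hA : ∀ l ∈ Finset.Icc j m.J, ∀ a, MeasurableSet[m.ℱ l] {ω | A l ω = a})
    {l : ℕ} (hjl : j ≤ l) (hl : l ≤ m.J) :
    (∀ z, MeasurableSet[m.ℱ l] {ω | control d.φ (fun i => A i ω) j y l = z}) ∧
    ∀ z, MeasurableSet[m.ℱ l] {ω | control d.φ (fun i => A i ω) j y (l + 1) = z} := by
  have hstep : ∀ l, j ≤ l → l ≤ m.J →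
      (∀ z, MeasurableSet[m.ℱ l] {ω | control d.φ (fun i => A i ω) j y l = z}) →
      ∀ z, MeasurableSet[m.ℱ l] {ω | control d.φ (fun i => A i ω) j y (l + 1) = z} := by
    intro l hjl hl h z
    have e : {ω | control d.φ (fun i => A i ω) j y (l + 1) = z} =
        ⋃ p ∈ {p : 𝓚 × 𝓛 | d.φ (l + 1) p.1 p.2 = z},
          ({ω | A l ω = p.1} ∩ {ω | control d.φ (fun i => A i ω) j y l = p.2}) := by
      ext ω
      simp [control_succ _ _ _ hjl]
    rw [e]
    exact MeasurableSet.biUnion (Set.to_countable _) fun p _ =>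
      (hA l (Finset.mem_Icc.2 ⟨hjl, hl⟩) p.1).inter (h p.2)
  have hmain : ∀ z, MeasurableSet[m.ℱ l] {ω | control d.φ (fun i => A i ω) j y l = z} := by
    induction l, hjl using Nat.le_induction with
    | base =>
      intro z
      simp only [control_self]
      exact MeasurableSet.const _
    | succ l hjl ih =>
      intro z
      exact m.ℱ.mono (Nat.le_succ l) _ (hstep l hjl (by omega) (ih (by omega)) z)
  exact ⟨hmain, hstep l hjl hl hmain⟩

variable (m d) in
/-- The cash-flow at time `l` plus the optimal conditional mean of the later ones. -/
noncomputable def rewardToGo (j : ℕ) (y : 𝓛) (A : ℕ → Ω → 𝓚) (l : ℕ) (ω : Ω) : ℝ :=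
  d.H l (A l ω) (control d.φ (fun i => A i ω) j y l) (m.X l ω) +
    kernelMean (m.transition l)
      (dpValue m d (l + 1) (d.φ (l + 1) (A l ω) (control d.φ (fun i => A i ω) j y l))) (m.X l ω)

section Reward

variable (hA : ∀ l ∈ Finset.Icc j m.J, ∀ a, MeasurableSet[m.ℱ l] {ω | A l ω = a})
include hA

lemma measurable_cashflow {l : ℕ} (hjl : j ≤ l) (hl : l ≤ m.J) :
    Measurable fun ω => d.H l (A l ω) (control d.φ (fun i => A i ω) j y l) (m.X l ω) :=
  measurable_comp_finite (fun a => m.ℱ.le l _ (hA l (Finset.mem_Icc.2 ⟨hjl, hl⟩) a))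
    (g := fun a ω => d.H l a (control d.φ (fun i => A i ω) j y l) (m.X l ω)) fun a =>
      measurable_comp_finite (fun z => m.ℱ.le l _ ((measurableSet_control hA hjl hl).1 z))
        (g := fun z ω => d.H l a z (m.X l ω)) fun z =>
          (d.measurable_H l a z).comp (m.measurable_X hl)

lemma measurable_dpValue_control {l : ℕ} (hjl : j ≤ l) (hl : l ≤ m.J) :
    Measurable fun ω => dpValue m d l (control d.φ (fun i => A i ω) j y l) (m.X l ω) :=
  measurable_comp_finite (fun z => m.ℱ.le l _ ((measurableSet_control hA hjl hl).1 z))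
    (g := fun z ω => dpValue m d l z (m.X l ω)) fun z =>
      (measurable_dpValue m d l z).comp (m.measurable_X hl)

lemma measurable_kernelMean_control {l : ℕ} (hjl : j ≤ l) (hl : l ≤ m.J) :
    Measurable fun ω => kernelMean (m.transition l)
      (dpValue m d (l + 1) (control d.φ (fun i => A i ω) j y (l + 1))) (m.X l ω) :=
  measurable_comp_finite (fun z => m.ℱ.le l _ ((measurableSet_control hA hjl hl).2 z))
    (g := fun z ω => kernelMean (m.transition l) (dpValue m d (l + 1) z) (m.X l ω)) fun z =>
      (measurable_kernelMean _ (measurable_dpValue m d (l + 1) z)).comp (m.measurable_X hl)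

include hH

/-- The expected total cash-flow of a policy is the dynamic programming value minus the expected
losses of the single decisions. -/
lemma integral_total_cashflow (hj : j ≤ m.J) :
    (∀ l ∈ Finset.Icc j m.J, Integrable (rewardToGo m d j y A l) (m.Pc j x) ∧
      Integrable (fun ω => dpValue m d l (control d.φ (fun i => A i ω) j y l) (m.X l ω))
        (m.Pc j x)) ∧
    ∫ ω, ∑ l ∈ Finset.Icc j m.J,
      d.H l (A l ω) (control d.φ (fun i => A i ω) j y l) (m.X l ω) ∂(m.Pc j x) =
    dpValue m d j y x + ∑ l ∈ Finset.Icc j m.J, (∫ ω, rewardToGo m d j y A l ω ∂(m.Pc j x) -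
      ∫ ω, dpValue m d l (control d.φ (fun i => A i ω) j y l) (m.X l ω) ∂(m.Pc j x)) := by
  have := m.prob_cond j hj x
  set Q := m.Pc j x with hQdef
  have hC : ∀ l, ∀ y x, |dpValue m d l y x| ≤ (m.J + 1 - l : ℕ) * C := abs_dpValue_le m d hH
  have hHi : ∀ l ∈ Finset.Icc j m.J, Integrable
      (fun ω => d.H l (A l ω) (control d.φ (fun i => A i ω) j y l) (m.X l ω)) Q := by
    intro l hl
    obtain ⟨h1, h2⟩ := Finset.mem_Icc.1 hl
    exact Integrable.of_bound (measurable_cashflow hA h1 h2).aestronglyMeasurable C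
      (Filter.Eventually.of_forall fun ω => hH l h2 _ _ _)
  have hVi : ∀ l ∈ Finset.Icc j m.J, Integrable
      (fun ω => dpValue m d l (control d.φ (fun i => A i ω) j y l) (m.X l ω)) Q := by
    intro l hl
    obtain ⟨h1, h2⟩ := Finset.mem_Icc.1 hl
    exact Integrable.of_bound (measurable_dpValue_control hA h1 h2).aestronglyMeasurable _
      (Filter.Eventually.of_forall fun ω => hC l _ _)
  have hKi : ∀ l ∈ Finset.Icc j m.J, Integrable (fun ω => kernelMean (m.transition l)
      (dpValue m d (l + 1) (control d.φ (fun i => A i ω) j y (l + 1))) (m.X l ω)) Q := by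
    intro l hl
    obtain ⟨h1, h2⟩ := Finset.mem_Icc.1 hl
    exact Integrable.of_bound (measurable_kernelMean_control hA h1 h2).aestronglyMeasurable _
      (Filter.Eventually.of_forall fun ω => abs_kernelMean_le _ (hC (l + 1) _) _)
  have hR : ∀ l ∈ Finset.Icc j m.J, rewardToGo m d j y A l = fun ω =>
      d.H l (A l ω) (control d.φ (fun i => A i ω) j y l) (m.X l ω) +
      kernelMean (m.transition l)
        (dpValue m d (l + 1) (control d.φ (fun i => A i ω) j y (l + 1))) (m.X l ω) := by
    intro l hl
    funext ω
    rw [rewardToGo, control_succ _ _ _ (Finset.mem_Icc.1 hl).1]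
  refine ⟨fun l hl => ⟨?_, hVi l hl⟩, ?_⟩
  · rw [hR l hl]
    exact (hHi l hl).add (hKi l hl)
  have hnext : ∀ l ∈ Finset.Icc j m.J, ∫ ω, rewardToGo m d j y A l ω ∂Q =
      ∫ ω, d.H l (A l ω) (control d.φ (fun i => A i ω) j y l) (m.X l ω) ∂Q +
      ∫ ω, dpValue m d (l + 1) (control d.φ (fun i => A i ω) j y (l + 1)) (m.X (l + 1) ω) ∂Q := by
    intro l hl
    obtain ⟨h1, h2⟩ := Finset.mem_Icc.1 hl
    rw [hR l hl, integral_add (hHi l hl) (hKi l hl)]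
    congr 1
    -- At the horizon no transition is available and none is needed: `dpValue` is `0` afterwards, so
    -- both sides vanish.
    rcases h2.lt_or_eq with h2' | rfl
    · exact (MarkovModel.IsMarkovAt.integral_next_control (m := m) (Q := Q)
        (fun A' hA' B hB => m.markov_cond j x l h1 h2' A' hA' B hB) h2'
        (measurable_dpValue m d (l + 1)) (hC (l + 1)) (measurableSet_control hA h1 h2).2).symm
    · simp_rw [kernelMean_dpValue_horizon, dpValue_of_lt m d (Nat.lt_succ_self _)]
  have hstart : ∫ ω, dpValue m d j (control d.φ (fun i => A i ω) j y j) (m.X j ω) ∂Q =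
      dpValue m d j y x := by
    simp_rw [control_self]
    have hm := measurable_dpValue m d j y
    have h1 := integral_map (μ := Q) (m.measurable_X hj).aemeasurable
      (f := dpValue m d j y) hm.aestronglyMeasurable
    rw [← h1, hQdef, m.start j hj x, integral_dirac' _ _ hm.stronglyMeasurable]
  have hend : ∫ ω, dpValue m d (m.J + 1) (control d.φ (fun i => A i ω) j y (m.J + 1))
      (m.X (m.J + 1) ω) ∂Q = 0 := by
    simp [dpValue_of_lt m d (Nat.lt_succ_self _)]
  -- The expected values along the controlled path telescope from `dpValue m d j y x`, by the
  -- deterministic start, to `0` at `J + 1`.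
  have htel : ∑ l ∈ Finset.Icc j m.J,
      (∫ ω, dpValue m d (l + 1) (control d.φ (fun i => A i ω) j y (l + 1)) (m.X (l + 1) ω) ∂Q -
        ∫ ω, dpValue m d l (control d.φ (fun i => A i ω) j y l) (m.X l ω) ∂Q) =
      - dpValue m d j y x := by
    have := Finset.sum_Ico_sub (fun l =>
      ∫ ω, dpValue m d l (control d.φ (fun i => A i ω) j y l) (m.X l ω) ∂Q)
      (show j ≤ m.J + 1 by omega)
    rw [hend, hstart, zero_sub] at this
    rw [← this]
    rfl
  rw [integral_finsetSum _ hHi]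
  have : ∑ l ∈ Finset.Icc j m.J, (∫ ω, rewardToGo m d j y A l ω ∂Q -
      ∫ ω, dpValue m d l (control d.φ (fun i => A i ω) j y l) (m.X l ω) ∂Q) =
      ∑ l ∈ Finset.Icc j m.J,
        ∫ ω, d.H l (A l ω) (control d.φ (fun i => A i ω) j y l) (m.X l ω) ∂Q +
      ∑ l ∈ Finset.Icc j m.J,
      (∫ ω, dpValue m d (l + 1) (control d.φ (fun i => A i ω) j y (l + 1)) (m.X (l + 1) ω) ∂Q -
        ∫ ω, dpValue m d l (control d.φ (fun i => A i ω) j y l) (m.X l ω) ∂Q) := by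
    rw [← Finset.sum_add_distrib]
    refine Finset.sum_congr rfl fun l hl => ?_
    rw [hnext l hl]
    ring
  rw [this, htel]
  ring

end Reward

-- Attains equality in `integral_total_cashflow`: a measurable maximiser is applied at every date,
-- so that no single decision loses anything.
variable (m d) in
lemma exists_greedy_policy [Nonempty 𝓚] (j : ℕ) (y : 𝓛) :
    ∃ A : ℕ → Ω → 𝓚, (∀ l ∈ Finset.Icc j m.J, ∀ a, MeasurableSet[m.ℱ l] {ω | A l ω = a}) ∧
      ∀ l ∈ Finset.Icc j m.J, ∀ ω,
        A l ω ∈ d.K l (control d.φ (fun i => A i ω) j y l) (m.X l ω) ∧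
        rewardToGo m d j y A l ω =
          dpValue m d l (control d.φ (fun i => A i ω) j y l) (m.X l ω) := by
  have hsel : ∀ (l : ℕ) (z : 𝓛), ∃ sel : 𝒳 → 𝓚, (∀ a, MeasurableSet {x | sel x = a}) ∧
      ∀ x, sel x ∈ d.K l z x ∧ d.H l (sel x) z x +
        kernelMean (m.transition l) (dpValue m d (l + 1) (d.φ (l + 1) (sel x) z)) x =
        ⨆ a : d.K l z x, (d.H l a z x +
          kernelMean (m.transition l) (dpValue m d (l + 1) (d.φ (l + 1) a z)) x) := fun l z =>
    exists_measurable_maximiser (d.measurable_K l z) (d.nonempty_K l z) (F := fun a x =>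
      d.H l a z x + kernelMean (m.transition l) (dpValue m d (l + 1) (d.φ (l + 1) a z)) x)
      fun a => (d.measurable_H l a z).add
        (measurable_kernelMean _ (measurable_dpValue m d (l + 1) _))
  choose sel hselm hsel using hsel
  -- Action and control determine each other, so the control is built first, by closed-loop
  -- recursion, and the actions are read off; `hYc` then identifies it with the control generated by
  -- these actions.
  let Y : ℕ → Ω → 𝓛 := fun n => Nat.rec (fun _ => y)
    (fun n Yn ω => d.φ (j + n + 1) (sel (j + n) (Yn ω) (m.X (j + n) ω)) (Yn ω)) n
  have hYs : ∀ n ω, Y (n + 1) ω =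
      d.φ (j + n + 1) (sel (j + n) (Y n ω) (m.X (j + n) ω)) (Y n ω) := fun n ω => rfl
  let A : ℕ → Ω → 𝓚 := fun l ω => sel l (Y (l - j) ω) (m.X l ω)
  have hA : ∀ n ω, A (j + n) ω = sel (j + n) (Y n ω) (m.X (j + n) ω) := fun n ω => by
    simp [A]
  have hYc : ∀ n ω, controlAfter d.φ (fun i => A i ω) j y n = Y n ω := by
    intro n ω
    induction n with
    | zero => rfl
    | succ n ih => rw [controlAfter, ih, hA, hYs]
  have hsm : ∀ n, j + n ≤ m.J → (∀ z, MeasurableSet[m.ℱ (j + n)] {ω | Y n ω = z}) →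
      ∀ a z, MeasurableSet[m.ℱ (j + n)]
        ({ω | Y n ω = z} ∩ {ω | sel (j + n) z (m.X (j + n) ω) = a}) := fun n hn h a z =>
    (h z).inter (m.adapted (j + n) hn (hselm (j + n) z a))
  have hYm : ∀ n, j + n ≤ m.J → ∀ z, MeasurableSet[m.ℱ (j + n)] {ω | Y n ω = z} := by
    intro n
    induction n with
    | zero => exact fun _ z => MeasurableSet.const (y = z)
    | succ n ih =>
      intro hn z
      have hn' : j + n ≤ m.J := by omega
      refine m.ℱ.mono (show j + n ≤ j + (n + 1) by omega) _ ?_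
      have e : {ω | Y (n + 1) ω = z} = ⋃ p ∈ {p : 𝓚 × 𝓛 | d.φ (j + n + 1) p.1 p.2 = z},
          ({ω | Y n ω = p.2} ∩ {ω | sel (j + n) p.2 (m.X (j + n) ω) = p.1}) := by
        ext ω
        simp only [Set.mem_ofPred_eq, Set.mem_iUnion, Set.mem_inter_iff, exists_prop, hYs]
        constructor
        · intro h
          exact ⟨(sel (j + n) (Y n ω) (m.X (j + n) ω), Y n ω), h, rfl, rfl⟩
        · rintro ⟨p, hp, h1, h2⟩
          rw [h1, h2, hp]
      rw [e]
      exact MeasurableSet.biUnion (Set.to_countable _) fun p _ => hsm n hn' (ih hn') p.1 p.2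
  refine ⟨A, fun l hl a => ?_, fun l hl ω => ?_⟩
  · obtain ⟨h1, h2⟩ := Finset.mem_Icc.1 hl
    obtain ⟨n, rfl⟩ := Nat.exists_eq_add_of_le h1
    have e : {ω | A (j + n) ω = a} =
        ⋃ z, ({ω | Y n ω = z} ∩ {ω | sel (j + n) z (m.X (j + n) ω) = a}) := by
      ext ω; simp [hA]
    rw [e]
    exact MeasurableSet.iUnion fun z => hsm n h2 (hYm n h2) a z
  · obtain ⟨h1, h2⟩ := Finset.mem_Icc.1 hl
    obtain ⟨n, rfl⟩ := Nat.exists_eq_add_of_le h1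
    have hc : control d.φ (fun i => A i ω) j y (j + n) = Y n ω := by
      rw [control, Nat.add_sub_cancel_left, hYc]
    rw [rewardToGo, hc, hA, dpValue_of_le m d h2]
    exact hsel (j + n) (Y n ω) (m.X (j + n) ω)

include hH in
/-- The dynamic programming principle. -/
theorem valueFunction_eq_dpValue (hj : j ≤ m.J) (y : 𝓛) (x : 𝒳) :
    valueFunction m d j y x = dpValue m d j y x := by
  have : Nonempty 𝓚 := ⟨(d.nonempty_K j y x).some⟩
  have := m.prob_cond j hj x
  obtain ⟨A, hA, hgreedy⟩ := exists_greedy_policy m d j y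
  have hadm : IsAdmissible m d j y x A := by
    refine ⟨fun l hl s _ => ?_, Filter.Eventually.of_forall fun ω l hl => (hgreedy l hl ω).1⟩
    have e : A l ⁻¹' s = ⋃ a ∈ s, {ω | A l ω = a} := by ext ω; simp
    rw [e]
    exact MeasurableSet.biUnion (Set.to_countable _) fun a _ => hA l hl a
  have hval : ∫ ω, ∑ l ∈ Finset.Icc j m.J,
      d.H l (A l ω) (control d.φ (fun i => A i ω) j y l) (m.X l ω) ∂(m.Pc j x) =
      dpValue m d j y x := by
    rw [(integral_total_cashflow hH hA hj).2]
    have : ∀ l ∈ Finset.Icc j m.J, (∫ ω, rewardToGo m d j y A l ω ∂(m.Pc j x) -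
      ∫ ω, dpValue m d l (control d.φ (fun i => A i ω) j y l) (m.X l ω) ∂(m.Pc j x)) = 0 := by
      intro l hl
      simp_rw [(hgreedy l hl _).2]
      exact sub_self _
    rw [Finset.sum_eq_zero this, add_zero]
  have hupper : ∀ A : {A : ℕ → Ω → 𝓚 // IsAdmissible m d j y x A},
      ∫ ω, ∑ l ∈ Finset.Icc j m.J,
        d.H l (A.1 l ω) (control d.φ (fun i => A.1 i ω) j y l) (m.X l ω) ∂(m.Pc j x) ≤
      dpValue m d j y x := by
    rintro ⟨A, hAm, hAK⟩
    have hA : ∀ l ∈ Finset.Icc j m.J, ∀ a, MeasurableSet[m.ℱ l] {ω | A l ω = a} :=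
      fun l hl a => hAm l hl (t := {a}) trivial
    obtain ⟨hint, htot⟩ := integral_total_cashflow (y := y) (x := x) hH hA hj
    dsimp only
    rw [htot]
    refine add_le_of_nonpos_right (Finset.sum_nonpos fun l hl => sub_nonpos.2 ?_)
    -- Admissibility holds almost surely, and there each decision is bounded by the maximum that
    -- defines `dpValue`.
    refine integral_mono_ae (hint l hl).1 (hint l hl).2 ?_
    filter_upwards [hAK] with ω hω
    rw [dpValue_of_le m d (Finset.mem_Icc.1 hl).2]
    exact le_iSup_of_mem (fun a => d.H l a (control d.φ (fun i => A i ω) j y l) (m.X l ω) +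
      kernelMean (m.transition l) (dpValue m d (l + 1)
        (d.φ (l + 1) a (control d.φ (fun i => A i ω) j y l))) (m.X l ω)) (hω l hl)
  refine le_antisymm ?_ ?_
  · have : Nonempty {A : ℕ → Ω → 𝓚 // IsAdmissible m d j y x A} := ⟨⟨A, hadm⟩⟩
    exact ciSup_le hupper
  · rw [← hval]
    exact le_ciSup (f := fun A : {A : ℕ → Ω → 𝓚 // IsAdmissible m d j y x A} =>
      ∫ ω, ∑ l ∈ Finset.Icc j m.J,
        d.H l (A.1 l ω) (control d.φ (fun i => A.1 i ω) j y l) (m.X l ω) ∂(m.Pc j x))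
      ⟨_, Set.forall_mem_range.2 hupper⟩ ⟨A, hadm⟩

include hH in
lemma contFunction_eq (hj : j < m.J) (z : 𝓛) (x : 𝒳) :
    contFunction m d j z x = kernelMean (m.transition j) (dpValue m d (j + 1) z) x := by
  rw [m.kernelMean_transition hj (measurable_dpValue m d (j + 1) z)]
  unfold contFunction
  simp_rw [valueFunction_eq_dpValue hH (Nat.succ_le_of_lt hj)]

end DynamicProgramming

/-! ### Conditioning on later samples by resampling one date. -/

section Resampling

variable {𝒳 : Type*} {J M : ℕ}

/-- Replace the sample of date `j` in `D` by `E`. -/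
def resample (j : Fin J) (D : Sample 𝒳 J M) (E : Fin M → 𝒳 × 𝒳) : Sample 𝒳 J M :=
  fun i => if i.1 = j then E i.2 else D i

lemma resample_apply_self (j : Fin J) (D : Sample 𝒳 J M) (E : Fin M → 𝒳 × 𝒳) (k : Fin M) :
    resample j D E (j, k) = E k := if_pos rfl

lemma resample_apply_of_ne {j : Fin J} (D : Sample 𝒳 J M) (E : Fin M → 𝒳 × 𝒳)
    {i : Fin J × Fin M} (h : i.1 ≠ j) : resample j D E i = D i := if_neg h

variable [MeasurableSpace 𝒳]

lemma measurable_resample (j : Fin J) :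
    Measurable fun p : Sample 𝒳 J M × (Fin M → 𝒳 × 𝒳) => resample j p.1 p.2 := by
  refine measurable_pi_lambda _ fun i => ?_
  by_cases h : i.1 = j
  · simp only [resample, h, if_true]
    exact (measurable_pi_apply i.2).comp measurable_snd
  · simp only [resample, h, if_false]
    exact (measurable_pi_apply i).comp measurable_fst

/-- This replaces conditioning on the other dates: an expectation over the sample becomes an
iterated one in which the date-`j` pairs are fresh and all others are frozen. It is checked on
boxes. -/
lemma measurePreserving_resample (ν : Fin J → Measure (𝒳 × 𝒳)) [∀ j, IsProbabilityMeasure (ν j)]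
    (j : Fin J) :
    MeasurePreserving (fun p : Sample 𝒳 J M × (Fin M → 𝒳 × 𝒳) => resample j p.1 p.2)
      ((Measure.pi fun i : Fin J × Fin M => ν i.1).prod (Measure.pi fun _ : Fin M => ν j))
      (Measure.pi fun i : Fin J × Fin M => ν i.1) := by
  refine ⟨measurable_resample j, (Measure.pi_eq fun s hs => ?_).symm⟩
  rw [Measure.map_apply (measurable_resample j) (MeasurableSet.univ_pi hs)]
  have e : (fun p : Sample 𝒳 J M × (Fin M → 𝒳 × 𝒳) => resample j p.1 p.2) ⁻¹' Set.univ.pi s =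
      (Set.univ.pi fun i => if i.1 = j then Set.univ else s i) ×ˢ
        (Set.univ.pi fun k => s (j, k)) := by
    ext p
    simp only [Set.mem_preimage, Set.mem_univ_pi, Set.mem_prod]
    constructor
    · intro h
      refine ⟨fun i => ?_, fun k => ?_⟩
      · split_ifs with hi
        · trivial
        · have := h i
          rwa [resample_apply_of_ne _ _ hi] at this
      · have := h (j, k)
        rwa [resample_apply_self] at this
    · rintro ⟨h1, h2⟩ ⟨a, k⟩
      by_cases ha : a = j
      · subst ha
        rw [resample_apply_self]
        exact h2 k
      · rw [resample_apply_of_ne _ _ ha]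
        have := h1 (a, k)
        rwa [if_neg ha] at this
  rw [e, Measure.prod_prod, Measure.pi_pi, Measure.pi_pi, Fintype.prod_prod_type,
    Fintype.prod_prod_type]
  have h1 : ∀ a : Fin J, ∏ k : Fin M, ν a (if a = j then Set.univ else s (a, k)) =
      if a = j then 1 else ∏ k, ν a (s (a, k)) := by
    intro a
    split_ifs <;> simp
  have h2 : ∏ k, ν j (s (j, k)) = ∏ a, if a = j then ∏ k, ν a (s (a, k)) else 1 := by
    simp
  simp only [h1]
  rw [h2, ← Finset.prod_mul_distrib]
  refine Finset.prod_congr rfl fun a _ => ?_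
  split_ifs <;> simp

lemma sampleInfo_le (j : ℕ) : sampleInfo 𝒳 J M j ≤ MeasurableSpace.pi :=
  iSup_le fun i => (measurable_pi_apply i.1).comap_le

/-- A function known at date `k` depends only on the samples of the dates `≥ k`. -/
lemma eq_of_measurable_sampleInfo {k : ℕ} {f : Sample 𝒳 J M → ℝ}
    (hf : Measurable[sampleInfo 𝒳 J M k] f) {D D' : Sample 𝒳 J M}
    (h : ∀ i : Fin J × Fin M, k ≤ i.1 → D i = D' i) : f D = f D' := by
  let r : Sample 𝒳 J M → ({i : Fin J × Fin M // k ≤ i.1} → 𝒳 × 𝒳) := fun D i => D i.1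
  have hle : sampleInfo 𝒳 J M k ≤ MeasurableSpace.comap r inferInstance := by
    refine iSup_le fun i => ?_
    rintro _ ⟨t, ht, rfl⟩
    exact ⟨Function.eval i ⁻¹' t, measurable_pi_apply i ht, rfl⟩
  -- The level set of `f` through `D` is a preimage under restriction to dates `≥ k`, so it contains
  -- every sample with the same restriction.
  obtain ⟨u, -, hu⟩ := hle _ (hf (measurableSet_singleton (f D)))
  have hD : D ∈ r ⁻¹' u := by rw [hu]; rfl
  have hr : r D = r D' := funext fun i => h i.1 i.2
  have hD' : D' ∈ r ⁻¹' u := by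
    change r D' ∈ u
    rw [← hr]
    exact hD
  rw [hu] at hD'
  exact (show f D' = f D from hD').symm

end Resampling

lemma eLpNorm_two_eq {α : Type*} [MeasurableSpace α] (μ : Measure α) (f : α → ℝ) :
    eLpNorm f 2 μ = (∫⁻ x, ENNReal.ofReal (f x ^ 2) ∂μ) ^ (1 / 2 : ℝ) := by
  rw [eLpNorm_eq_lintegral_rpow_enorm_toReal two_ne_zero ENNReal.ofNat_ne_top]
  simp only [ENNReal.toReal_ofNat]
  congr 1
  refine lintegral_congr fun x => ?_
  rw [← ofReal_norm, ENNReal.ofReal_rpow_of_nonneg (norm_nonneg _) (by norm_num),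
    Real.rpow_two, Real.norm_eq_abs, sq_abs]

/-! ### The regression error at one date. -/

section Estimates

open ProbabilityTheory

variable {Ω 𝒳 𝓚 𝓛 : Type*} [MeasurableSpace Ω] [MeasurableSpace 𝒳]
variable {d : ControlData 𝒳 𝓚 𝓛} {W : ℝ} {Ψ : ℕ → Set (𝒳 → ℝ)}

section

variable {J M : ℕ} {proj : ℕ → 𝓛 → Sample 𝒳 J M → 𝒳 → ℝ}

lemma IsRegression.measurable_proj (h : IsRegression d W Ψ proj) {j : ℕ} (hj : j < J) (z : 𝓛) :
    Measurable fun p : Sample 𝒳 J M × 𝒳 => proj j z p.1 p.2 :=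
  (h.meas ⟨j, hj⟩ z).mono (sup_le_sup (MeasurableSpace.comap_mono (sampleInfo_le j)) le_rfl) le_rfl

lemma IsRegression.proj_eq (h : IsRegression d W Ψ proj) {j : ℕ} (hj : j < J) (z : 𝓛)
    {D D' : Sample 𝒳 J M} (hD : ∀ i : Fin J × Fin M, j ≤ i.1 → D i = D' i) (x : 𝒳) :
    proj j z D x = proj j z D' x := by
  refine eq_of_measurable_sampleInfo (k := j) (f := fun D => proj j z D x) ?_ hD
  have h1 := h.meas ⟨j, hj⟩ z
  exact h1.comp (@measurable_prodMk_right _ _ (sampleInfo 𝒳 J M j) _ x)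

lemma IsRegression.estV_eq (h : IsRegression d W Ψ proj) (j : ℕ) (y : 𝓛)
    {D D' : Sample 𝒳 J M} (hD : ∀ i : Fin J × Fin M, j ≤ i.1 → D i = D' i) :
    estV d W proj j y D = estV d W proj j y D' := by
  funext x
  unfold estV estC
  split_ifs with hj
  · simp_rw [h.proj_eq hj _ hD]
  · rfl

lemma IsRegression.measurable_estC (h : IsRegression d W Ψ proj) (hW : 0 ≤ W) {j : ℕ} (hj : j < J)
    (z : 𝓛) : Measurable fun p : Sample 𝒳 J M × 𝒳 => estC W proj j z p.1 p.2 :=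
  (measurable_truncate hW).comp (h.measurable_proj hj z)

lemma IsRegression.measurable_estV [Finite 𝓚] (h : IsRegression d W Ψ proj) (hW : 0 ≤ W) (j : ℕ)
    (y : 𝓛) : Measurable fun p : Sample 𝒳 J M × 𝒳 => estV d W proj j y p.1 p.2 := by
  have hH : ∀ a, Measurable fun p : Sample 𝒳 J M × 𝒳 => d.H j a y p.2 := fun a =>
    (d.measurable_H j a y).comp measurable_snd
  unfold estV
  split_ifs with hj
  · exact measurable_iSup_set (α := Sample 𝒳 J M × 𝒳) (K := fun p => d.K j y p.2)
      (F := fun a p => d.H j a y p.2 + estC W proj j (d.φ (j + 1) a y) p.1 p.2)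
      (fun a => measurable_snd (d.measurable_K j y a)) (fun p => d.nonempty_K j y p.2)
      fun a => (hH a).add (h.measurable_estC hW hj _)
  · exact measurable_iSup_set (α := Sample 𝒳 J M × 𝒳) (K := fun p => d.K j y p.2)
      (F := fun a p => d.H j a y p.2)
      (fun a => measurable_snd (d.measurable_K j y a)) (fun p => d.nonempty_K j y p.2) hH

/-- Labels are a cash-flow plus an estimate truncated at `W`, so they may exceed `W`; with `C ≤ W`
they stay within `2 * W`. -/
lemma abs_estV_le [Finite 𝓚] (hW : 0 ≤ W) {C : ℝ} {j : ℕ} (hH : ∀ a y x, |d.H j a y x| ≤ C)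
    (y : 𝓛) (D : Sample 𝒳 J M) (x : 𝒳) : |estV d W proj j y D x| ≤ C + W := by
  unfold estV
  split_ifs with hj
  · exact abs_iSup_le (d.nonempty_K j y x)
      (f := fun a => d.H j a y x + estC W proj j (d.φ (j + 1) a y) D x) fun a _ =>
      (abs_add_le _ _).trans (add_le_add (hH a y x) (abs_truncate_le hW _))
  · exact abs_iSup_le (d.nonempty_K j y x) (f := fun a => d.H j a y x) fun a _ =>
      (hH a y x).trans (by linarith)

end

variable {m : MarkovModel Ω 𝒳} {M : ℕ} {proj : ℕ → 𝓛 → Sample 𝒳 m.J M → 𝒳 → ℝ}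

lemma IsRegression.condC_eq [Finite 𝓚] (h : IsRegression d W Ψ proj) (hW : 0 ≤ W) {j : ℕ}
    (hj : j < m.J) (z : 𝓛) (D : Sample 𝒳 m.J M) (x : 𝒳) :
    condC m d W proj j z D x = kernelMean (m.transition j) (estV d W proj (j + 1) z D) x :=
  (m.kernelMean_transition hj
    ((h.measurable_estV hW (j + 1) z).comp (measurable_prodMk_left (x := D))) x).symm

lemma IsRegression.measurable_condC [Finite 𝓚] (h : IsRegression d W Ψ proj) (hW : 0 ≤ W) {j : ℕ}
    (hj : j < m.J) (z : 𝓛) :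
    Measurable fun p : 𝒳 × Sample 𝒳 m.J M => condC m d W proj j z p.2 p.1 := by
  simp_rw [h.condC_eq hW hj]
  have h1 : StronglyMeasurable fun q : (𝒳 × Sample 𝒳 m.J M) × 𝒳 =>
      estV d W proj (j + 1) z q.1.2 q.2 :=
    ((h.measurable_estV hW (j + 1) z).comp
      ((measurable_snd.comp measurable_fst).prodMk measurable_snd)).stronglyMeasurable
  exact (h1.integral_kernel_prod_right'
    (κ := (m.transition j).comap Prod.fst measurable_fst)).measurable

instance : IsProbabilityMeasure m.P := m.prob

lemma isProbabilityMeasure_marginal {j : ℕ} (hj : j ≤ m.J) :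
    IsProbabilityMeasure (marginal m j) :=
  Measure.isProbabilityMeasure_map (m.measurable_X hj).aemeasurable

lemma map_pair_eq_compProd {j : ℕ} (hj : j < m.J) :
    m.P.map (fun ω => (m.X j ω, m.X (j + 1) ω)) = marginal m j ⊗ₘ m.transition j :=
  MarkovModel.IsMarkovAt.map_pair (m := m) (Q := m.P)
    (fun A hA B hB => m.markov j hj A hA B hB) hj

lemma sampleLaw_eq : sampleLaw m M = Measure.pi fun i : Fin m.J × Fin M =>
    marginal m i.1 ⊗ₘ m.transition i.1 := by
  unfold sampleLaw
  congr 1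
  funext i
  exact map_pair_eq_compProd i.1.2

lemma isProbabilityMeasure_compProd_marginal (i : Fin m.J) :
    IsProbabilityMeasure (marginal m i ⊗ₘ m.transition i) := by
  have := isProbabilityMeasure_marginal (m := m) i.2.le
  infer_instance

instance : IsProbabilityMeasure (sampleLaw m M) := by
  rw [sampleLaw_eq]
  have := isProbabilityMeasure_compProd_marginal (m := m)
  infer_instance

/-- The mean square error of the regression estimate at one date, truncated at a level that bounds
all labels. -/
lemma lintegral_regression_error_le [Finite 𝓚] (h : IsRegression d W Ψ proj) (hW : 1 ≤ W)
    (hM : 1 ≤ M) {C : ℝ} (hH : ∀ j ≤ m.J, ∀ a y x, |d.H j a y x| ≤ C) (hCW : C ≤ W) {j : ℕ}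
    (hj : j < m.J) (z : 𝓛) {V : ℕ} (hV : vcDim (Ψ j) = V) {w : 𝒳 → ℝ} (hwΨ : w ∈ Ψ j)
    (hw : Measurable w) :
    ∫⁻ p, ENNReal.ofReal
        ((truncate (2 * W) (proj j z p.2 p.1) - condC m d W proj j z p.2 p.1) ^ 2)
        ∂((marginal m j).prod (sampleLaw m M)) ≤
      ENNReal.ofReal (1488 * W ^ 4 * ((1 + Real.log M) / M)) * V +
        2 * ∫⁻ p, ENNReal.ofReal ((condC m d W proj j z p.2 p.1 - w p.1) ^ 2)
          ∂((marginal m j).prod (sampleLaw m M)) := by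
  have hW0 : 0 ≤ W := by linarith
  have := isProbabilityMeasure_marginal hj.le
  have hpm := isProbabilityMeasure_compProd_marginal (m := m)
  have hcm := h.measurable_condC hW0 hj z
  have hpr := h.measurable_proj hj z
  have htr := measurable_truncate (show 0 ≤ 2 * W by linarith)
  have hf1 : Measurable fun p : 𝒳 × Sample 𝒳 m.J M => ENNReal.ofReal
        ((truncate (2 * W) (proj j z p.2 p.1) - condC m d W proj j z p.2 p.1) ^ 2) :=
    (((htr.comp (hpr.comp measurable_swap)).sub hcm).pow_const 2).ennreal_ofReal
  have hf2 : Measurable fun p : 𝒳 × Sample 𝒳 m.J M =>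
      ENNReal.ofReal ((condC m d W proj j z p.2 p.1 - w p.1) ^ 2) :=
    ((hcm.sub (hw.comp measurable_fst)).pow_const 2).ennreal_ofReal
  rw [lintegral_prod_symm _ hf1.aemeasurable, lintegral_prod_symm _ hf2.aemeasurable]
  have hG : Measurable fun D : Sample 𝒳 m.J M => ∫⁻ x, ENNReal.ofReal
      ((truncate (2 * W) (proj j z D x) - condC m d W proj j z D x) ^ 2) ∂(marginal m j) :=
    hf1.lintegral_prod_left'
  have hres := measurePreserving_resample (M := M)
    (fun i : Fin m.J => marginal m i ⊗ₘ m.transition i) ⟨j, hj⟩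
  rw [← sampleLaw_eq] at hres
  have hGc : Measurable fun p : Sample 𝒳 m.J M × (Fin M → 𝒳 × 𝒳) => ∫⁻ x, ENNReal.ofReal
      ((truncate (2 * W) (proj j z (resample ⟨j, hj⟩ p.1 p.2) x) -
        condC m d W proj j z (resample ⟨j, hj⟩ p.1 p.2) x) ^ 2) ∂(marginal m j) :=
    hG.comp hres.measurable
  rw [← hres.lintegral_comp hG, lintegral_prod _ hGc.aemeasurable]
  -- Labels at date `j` use only samples of dates `≥ j + 1`, so resampling date `j` leaves them
  -- unchanged.
  have hinv : ∀ (D : Sample 𝒳 m.J M) (E : Fin M → 𝒳 × 𝒳),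
      estV d W proj (j + 1) z (resample ⟨j, hj⟩ D E) = estV d W proj (j + 1) z D := by
    intro D E
    refine h.estV_eq _ _ fun i hi => resample_apply_of_ne _ _ ?_
    rintro hij
    rw [hij] at hi
    simp at hi
  have hlog : 0 ≤ Real.log M := Real.log_nonneg (by exact_mod_cast hM)
  -- The level `2 * W` turns `372` into `1488`. The argument yields `W ^ 2`, which is at most `W ^
  -- 4` because `1 ≤ W`.
  have hcoef : 372 * (2 * W) ^ 2 * ((1 + Real.log M) / M) ≤
      1488 * W ^ 4 * ((1 + Real.log M) / M) := by
    have : W ^ 2 ≤ W ^ 4 := pow_le_pow_right₀ hW (by norm_num)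
    have h0 : 0 ≤ (1 + Real.log M) / M := by positivity
    nlinarith
  have key : ∀ D : Sample 𝒳 m.J M, ∫⁻ E, ∫⁻ x, ENNReal.ofReal
      ((truncate (2 * W) (proj j z (resample ⟨j, hj⟩ D E) x) -
        condC m d W proj j z (resample ⟨j, hj⟩ D E) x) ^ 2) ∂(marginal m j)
      ∂(Measure.pi fun _ : Fin M => marginal m j ⊗ₘ m.transition j) ≤
      ENNReal.ofReal (1488 * W ^ 4 * ((1 + Real.log M) / M)) * V +
        2 * ∫⁻ x, ENNReal.ofReal ((condC m d W proj j z D x - w x) ^ 2) ∂(marginal m j) := by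
    intro D
    simp_rw [h.condC_eq hW0 hj, hinv]
    refine (lintegral_sq_error_le (marginal m j) (m.transition j) (Ψ := Ψ j)
      (L := 2 * W) (v := estV d W proj (j + 1) z D)
      (est := fun E => proj j z (resample ⟨j, hj⟩ D E)) hV (by linarith) hM
      ((h.measurable_estV hW0 (j + 1) z).comp (measurable_prodMk_left (x := D)))
      (fun x => (abs_estV_le hW0 (hH (j + 1) hj) z D x).trans (by linarith))
      (hpr.comp (((measurable_resample ⟨j, hj⟩).comp
        ((measurable_prodMk_left (x := D)).comp measurable_fst)).prodMk measurable_snd))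
      (fun E => h.mem ⟨j, hj⟩ z _) hwΨ hw fun E => ?_).trans ?_
    · have := h.isMin ⟨j, hj⟩ z (resample ⟨j, hj⟩ D E) w hwΨ
      simp only [resample_apply_self, hinv] at this
      exact this
    · exact add_le_add (by gcongr) le_rfl
  refine (lintegral_mono key).trans (le_of_eq ?_)
  have hI : Measurable fun D : Sample 𝒳 m.J M =>
      ∫⁻ x, ENNReal.ofReal ((condC m d W proj j z D x - w x) ^ 2) ∂(marginal m j) :=
    hf2.lintegral_prod_left'
  rw [lintegral_add_left measurable_const, lintegral_const_mul _ hI, lintegral_const, measure_univ,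
    mul_one]

/-- The `L₂` error of a single truncated regression is bounded by the stochastic error and the
approximation error. -/
lemma eLpNorm_proj_sub_condC_le [Finite 𝓚] {C : ℝ}
    (hH : ∀ j ≤ m.J, ∀ a y x, |d.H j a y x| ≤ C) (h : IsRegression d W Ψ proj) (hW : 1 ≤ W) (hM : 1 ≤ M)
    (hCW : C ≤ W) {j : ℕ} (hj : j < m.J) (hΨ : ∀ w ∈ Ψ j, Measurable w) (z : 𝓛) :
    eLpNorm (fun p : 𝒳 × Sample 𝒳 m.J M =>
      truncate (2 * W) (proj j z p.2 p.1) - condC m d W proj j z p.2 p.1) 2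
      ((marginal m j).prod (sampleLaw m M)) ≤
    stochError 1488 W M (Ψ j) +
      ENNReal.ofReal (Real.sqrt 2) * approxError m d W proj (Ψ j) j z := by
  have hlog : 0 ≤ Real.log M := Real.log_nonneg (by exact_mod_cast hM)
  have hM' : (0 : ℝ) < M := by exact_mod_cast hM
  have hs2 : ENNReal.ofReal (Real.sqrt 2) ≠ 0 := by simp
  have hsqrt : ENNReal.ofReal (Real.sqrt 2) = (2 : ENNReal) ^ (1 / 2 : ℝ) := by
    rw [Real.sqrt_eq_rpow, ← ENNReal.ofReal_rpow_of_nonneg (by norm_num) (by norm_num)]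
    simp
  unfold approxError
  rw [ENNReal.mul_iInf_of_ne hs2 ENNReal.ofReal_ne_top, ENNReal.add_iInf]
  refine le_iInf fun w => ?_
  by_cases hw : w ∈ Ψ j
  swap
  · simp [hw, ENNReal.mul_top hs2]
  simp only [hw, iInf_pos]
  rw [eLpNorm_two_eq, eLpNorm_two_eq, hsqrt, ← ENNReal.mul_rpow_of_nonneg _ _ (by norm_num),
    stochError]
  refine le_trans ?_ (ENNReal.rpow_add_le_add_rpow _ _ (by norm_num) (by norm_num))
  refine ENNReal.rpow_le_rpow ?_ (by norm_num)
  rcases hV : vcDim (Ψ j) with _ | V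
  -- For infinite dimension the bound is infinite, the coefficient being strictly positive.
  · have hpos : 0 < 1488 * W ^ 4 * ((1 + Real.log M) / M) := by positivity
    have htop : ((⊤ : ℕ∞) : ENNReal) = ⊤ := rfl
    refine le_trans le_top (le_of_eq ?_)
    change ⊤ = ENNReal.ofReal _ * ((⊤ : ℕ∞) : ENNReal) + _
    rw [htop, ENNReal.mul_top (by simpa using hpos), top_add]
  · exact lintegral_regression_error_le h hW hM hH hCW hj z hV hw (hΨ w hw)

end Estimates

/-! ### Propagation of the error and the recursion. -/

section Propagation

open ProbabilityTheory

lemma ofReal_sq_integral_le {α : Type*} [MeasurableSpace α] (μ : Measure α)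
    [IsProbabilityMeasure μ] {f : α → ℝ} (hf : Measurable f) {B : ℝ} (hB : ∀ x, |f x| ≤ B) :
    ENNReal.ofReal ((∫ x, f x ∂μ) ^ 2) ≤ ∫⁻ x, ENNReal.ofReal (f x ^ 2) ∂μ := by
  have hi : Integrable f μ := Integrable.of_bound hf.aestronglyMeasurable B
    (Filter.Eventually.of_forall hB)
  have hi2 : Integrable (fun x => f x ^ 2) μ := by
    refine Integrable.of_bound (hf.pow_const 2).aestronglyMeasurable (B ^ 2)
      (Filter.Eventually.of_forall fun x => ?_)
    rw [Real.norm_of_nonneg (sq_nonneg _), ← sq_abs]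
    exact pow_le_pow_left₀ (abs_nonneg _) (hB x) 2
  rw [← ofReal_integral_eq_lintegral_ofReal hi2 (Filter.Eventually.of_forall fun x => sq_nonneg _)]
  exact ENNReal.ofReal_le_ofReal ((even_two.convexOn_pow (𝕜 := ℝ)).map_integral_le
    (by fun_prop) isClosed_univ (Filter.Eventually.of_forall fun _ => trivial) hi hi2)

variable {Ω 𝒳 𝓚 𝓛 : Type*} [MeasurableSpace Ω] [MeasurableSpace 𝒳] [Finite 𝓚] [Fintype 𝓛]
variable {m : MarkovModel Ω 𝒳} {d : ControlData 𝒳 𝓚 𝓛} {W C : ℝ} {Ψ : ℕ → Set (𝒳 → ℝ)}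
variable {M : ℕ} {proj : ℕ → 𝓛 → Sample 𝒳 m.J M → 𝒳 → ℝ}
variable (hH : ∀ j ≤ m.J, ∀ a y x, |d.H j a y x| ≤ C)
include hH

lemma measurable_contFunction {j : ℕ} (hj : j < m.J) (z : 𝓛) :
    Measurable (contFunction m d j z) := by
  rw [show contFunction m d j z = _ from funext fun x => contFunction_eq hH hj z x]
  exact measurable_kernelMean _ (measurable_dpValue m d (j + 1) z)

lemma abs_contFunction_le (hC : 0 ≤ C) {j : ℕ} (hj : j < m.J) (z : 𝓛) (x : 𝒳) :
    |contFunction m d j z x| ≤ m.J * C := by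
  rw [contFunction_eq hH hj]
  refine (abs_kernelMean_le _ (abs_dpValue_le m d hH (j + 1) z) x).trans ?_
  gcongr
  omega

lemma abs_estV_sub_dpValue_le {j : ℕ} (hj : j < m.J) (y : 𝓛) (D : Sample 𝒳 m.J M) (x : 𝒳) :
    |estV d W proj j y D x - dpValue m d j y x| ≤
      ⨆ z : 𝓛, |estC W proj j z D x - contFunction m d j z x| := by
  rw [dpValue_of_le m d hj.le, estV, if_pos hj]
  refine abs_iSup_sub_iSup_le (d.nonempty_K j y x)
    (f := fun a => d.H j a y x + estC W proj j (d.φ (j + 1) a y) D x)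
    (g := fun a => d.H j a y x +
      kernelMean (m.transition j) (dpValue m d (j + 1) (d.φ (j + 1) a y)) x) fun a _ => ?_
  rw [← contFunction_eq hH hj, add_sub_add_left_eq_sub]
  exact le_ciSup (f := fun z : 𝓛 => |estC W proj j z D x - contFunction m d j z x|)
    (Set.finite_range _).bddAbove _

/-- At the horizon the value is known exactly, with no regression in it; this matches the convention
`ℰ_J = 0`. -/
lemma condC_eq_contFunction_of_last (h : IsRegression d W Ψ proj) (hW : 0 ≤ W) {j : ℕ}
    (hj : j + 1 = m.J) (z : 𝓛) (D : Sample 𝒳 m.J M) (x : 𝒳) :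
    condC m d W proj j z D x = contFunction m d j z x := by
  rw [h.condC_eq hW (by omega), contFunction_eq hH (by omega)]
  congr 1
  funext y
  rw [estV, if_neg (by omega), hj, dpValue_horizon]

/-- The error of the conditional means of the estimated values is at most the regression error of
the next date. -/
lemma eLpNorm_iSup_condC_sub_le (h : IsRegression d W Ψ proj) (hW : 0 ≤ W) (hC : 0 ≤ C)
    (hCW : m.J * C ≤ W) {j : ℕ} (hj : j < m.J) :
    eLpNorm (fun p : 𝒳 × Sample 𝒳 m.J M =>
      ⨆ z : 𝓛, |condC m d W proj j z p.2 p.1 - contFunction m d j z p.1|) 2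
      ((marginal m j).prod (sampleLaw m M)) ≤ regError m d W proj (j + 1) := by
  rcases (show j + 1 ≤ m.J from hj).lt_or_eq with hj1 | hj1
  swap
  · simp_rw [condC_eq_contFunction_of_last hH h hW hj1]
    simp
  rcases isEmpty_or_nonempty 𝓛 with hE | hE
  · simp
  have := isProbabilityMeasure_marginal hj.le
  have := isProbabilityMeasure_marginal hj1.le
  rw [regError, if_pos hj1]
  let S : Sample 𝒳 m.J M × 𝒳 → ℝ := fun p =>
    ⨆ z : 𝓛, |estC W proj (j + 1) z p.1 p.2 - contFunction m d (j + 1) z p.2|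
  have hSm : Measurable S := Measurable.iSup fun z => by
    have h1 := h.measurable_estC hW hj1 z
    have h2 : Measurable fun p : Sample 𝒳 m.J M × 𝒳 => contFunction m d (j + 1) z p.2 :=
      (measurable_contFunction hH hj1 z).comp measurable_snd
    exact (h1.sub h2).abs
  have hS0 : ∀ p, 0 ≤ S p := fun p => Real.iSup_nonneg fun z => abs_nonneg _
  have hSB : ∀ p, |S p| ≤ W + W := by
    intro p
    rw [abs_of_nonneg (hS0 p)]
    exact ciSup_le fun z => (abs_sub _ _).trans (add_le_add (abs_truncate_le hW _)
      ((abs_contFunction_le hH hC hj1 z _).trans hCW))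
  have hSD : ∀ D, Measurable fun y => S (D, y) := fun D =>
    hSm.comp (measurable_prodMk_left (x := D))
  have hbound : ∀ D x, (⨆ z : 𝓛, |condC m d W proj j z D x - contFunction m d j z x|) ≤
      ∫ y, S (D, y) ∂(m.transition j x) := by
    intro D x
    refine ciSup_le fun z => ?_
    rw [h.condC_eq hW hj, contFunction_eq hH hj, kernelMean, kernelMean]
    have hi1 : Integrable (estV d W proj (j + 1) z D) (m.transition j x) :=
      Integrable.of_bound ((h.measurable_estV hW (j + 1) z).comp
        (measurable_prodMk_left (x := D))).aestronglyMeasurable _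
        (Filter.Eventually.of_forall fun y => abs_estV_le hW (hH (j + 1) hj1.le) z D y)
    have hi2 : Integrable (dpValue m d (j + 1) z) (m.transition j x) :=
      Integrable.of_bound (measurable_dpValue m d (j + 1) z).aestronglyMeasurable _
        (Filter.Eventually.of_forall fun y => abs_dpValue_le m d hH (j + 1) z y)
    rw [← integral_sub hi1 hi2]
    have hiS : Integrable (fun y => S (D, y)) (m.transition j x) :=
      Integrable.of_bound (hSD D).aestronglyMeasurable _
        (Filter.Eventually.of_forall fun y => hSB _)
    exact norm_integral_le_of_norm_le
      (f := fun y => estV d W proj (j + 1) z D y - dpValue m d (j + 1) z y) hiS (Filter.Eventually.of_forall fun y =>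
      abs_estV_sub_dpValue_le hH hj1 z D y)
  rw [eLpNorm_two_eq, eLpNorm_two_eq]
  refine ENNReal.rpow_le_rpow ?_ (by norm_num)
  have hSsw : Measurable fun p : 𝒳 × Sample 𝒳 m.J M => ENNReal.ofReal (S (p.2, p.1) ^ 2) :=
    ((hSm.comp measurable_swap).pow_const 2).ennreal_ofReal
  have hSint : Measurable fun p : 𝒳 × Sample 𝒳 m.J M =>
      ∫⁻ y, ENNReal.ofReal (S (p.2, y) ^ 2) ∂(m.transition j p.1) := by
    have h1 : Measurable fun q : (𝒳 × Sample 𝒳 m.J M) × 𝒳 =>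
        ENNReal.ofReal (S (q.1.2, q.2) ^ 2) :=
      ((hSm.comp ((measurable_snd.comp measurable_fst).prodMk
        measurable_snd)).pow_const 2).ennreal_ofReal
    exact h1.lintegral_kernel_prod_right' (κ := (m.transition j).comap Prod.fst measurable_fst)
  calc ∫⁻ p, ENNReal.ofReal ((⨆ z : 𝓛, |condC m d W proj j z p.2 p.1 -
          contFunction m d j z p.1|) ^ 2) ∂((marginal m j).prod (sampleLaw m M))
      ≤ ∫⁻ p, ∫⁻ y, ENNReal.ofReal (S (p.2, y) ^ 2) ∂(m.transition j p.1)
          ∂((marginal m j).prod (sampleLaw m M)) := by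
        refine lintegral_mono fun p => ?_
        refine le_trans (ENNReal.ofReal_le_ofReal ?_)
          (ofReal_sq_integral_le (m.transition j p.1) (hSD p.2) fun y => hSB _)
        exact pow_le_pow_left₀ (Real.iSup_nonneg fun z => abs_nonneg _) (hbound p.2 p.1) 2
    _ = ∫⁻ D, ∫⁻ x, ∫⁻ y, ENNReal.ofReal (S (D, y) ^ 2) ∂(m.transition j x) ∂(marginal m j)
          ∂(sampleLaw m M) := lintegral_prod_symm _ hSint.aemeasurable
    _ = ∫⁻ D, ∫⁻ y, ENNReal.ofReal (S (D, y) ^ 2) ∂(marginal m (j + 1)) ∂(sampleLaw m M) := by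
        refine lintegral_congr fun D => ?_
        have hm : Measurable fun y => ENNReal.ofReal (S (D, y) ^ 2) :=
          ((hSD D).pow_const 2).ennreal_ofReal
        have hm2 : Measurable fun q : 𝒳 × 𝒳 => ENNReal.ofReal (S (D, q.2) ^ 2) :=
          hm.comp measurable_snd
        -- The second marginal of the joint law of `(X_j, X_{j+1})` is `μ_{j+1}`; the sample stays
        -- fixed as an independent parameter.
        rw [← Measure.lintegral_compProd hm2, ← map_pair_eq_compProd hj,
          lintegral_map hm2
            ((m.measurable_X hj.le).prodMk (m.measurable_X hj)),
          marginal, lintegral_map hm (m.measurable_X hj)]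
    _ = _ := (lintegral_prod_symm _ hSsw.aemeasurable).symm

/-- One step of the error recursion. -/
theorem regError_le (h : IsRegression d W Ψ proj) (hWC : W = m.J * C) (hW : 1 ≤ W) (hM : 1 ≤ M)
    {j : ℕ} (hj : j < m.J) (hΨ : ∀ w ∈ Ψ j, Measurable w) :
    regError m d W proj j ≤
      (Fintype.card 𝓛 : ENNReal) *
        (stochError 1488 W M (Ψ j) +
          ENNReal.ofReal (Real.sqrt 2) * ⨆ z : 𝓛, approxError m d W proj (Ψ j) j z) +
      (Fintype.card 𝓛 : ENNReal) * regError m d W proj (j + 1) := by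
  have hW0 : 0 ≤ W := by linarith
  rcases isEmpty_or_nonempty 𝓛 with hE | hE
  · simp [regError]
  have hJ : (1 : ℝ) ≤ m.J := by exact_mod_cast (by omega : 1 ≤ m.J)
  have hC : 0 ≤ C := by
    by_contra! hneg
    nlinarith
  have hCW : C ≤ W := by
    rw [hWC]
    nlinarith
  set ν := (marginal m j).prod (sampleLaw m M)
  let f : 𝓛 → 𝒳 × Sample 𝒳 m.J M → ℝ := fun z p =>
    truncate (2 * W) (proj j z p.2 p.1) - condC m d W proj j z p.2 p.1
  let R : 𝒳 × Sample 𝒳 m.J M → ℝ := fun p =>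
    ⨆ z : 𝓛, |condC m d W proj j z p.2 p.1 - contFunction m d j z p.1|
  have hcm := fun z => h.measurable_condC hW0 hj z
  have hfm : ∀ z, Measurable (f z) := fun z =>
    ((measurable_truncate (by linarith)).comp
      ((h.measurable_proj hj z).comp measurable_swap)).sub (hcm z)
  have hRm : Measurable R := Measurable.iSup fun z =>
    ((hcm z).sub ((measurable_contFunction hH hj z).comp measurable_fst)).abs
  have hpt : ∀ p, ‖⨆ z : 𝓛, |estC W proj j z p.2 p.1 - contFunction m d j z p.1|‖ ≤
      ∑ z, |f z p| + R p := by
    intro p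
    rw [Real.norm_of_nonneg (Real.iSup_nonneg fun z => abs_nonneg _)]
    refine ciSup_le fun z => ?_
    have hcb : |contFunction m d j z p.1| ≤ W :=
      hWC ▸ abs_contFunction_le hH hC hj z p.1
    -- `C̃_j` may exceed `W`, so the comparison goes through its truncation, which lies no further
    -- from `C*_j` than `C̃_j` does.
    have h1 : |estC W proj j z p.2 p.1 - truncate W (condC m d W proj j z p.2 p.1)| ≤ |f z p| := by
      rw [estC, ← truncate_truncate hW0 (by linarith : W ≤ 2 * W)]
      exact abs_truncate_sub_truncate_le hW0 _ _
    have h2 := abs_truncate_sub_le (r := condC m d W proj j z p.2 p.1) hcb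
    have h3 : |f z p| ≤ ∑ z, |f z p| :=
      Finset.single_le_sum (f := fun z => |f z p|) (fun z _ => abs_nonneg _) (Finset.mem_univ z)
    have h4 : |condC m d W proj j z p.2 p.1 - contFunction m d j z p.1| ≤ R p :=
      le_ciSup (f := fun z : 𝓛 => |condC m d W proj j z p.2 p.1 - contFunction m d j z p.1|)
        (Set.finite_range _).bddAbove z
    have h5 := abs_sub_le (estC W proj j z p.2 p.1)
      (truncate W (condC m d W proj j z p.2 p.1)) (contFunction m d j z p.1)
    linarith
  have hcard : (1 : ENNReal) ≤ Fintype.card 𝓛 := by exact_mod_cast Fintype.card_pos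
  calc regError m d W proj j = eLpNorm (fun p : 𝒳 × Sample 𝒳 m.J M =>
        ⨆ z : 𝓛, |estC W proj j z p.2 p.1 - contFunction m d j z p.1|) 2 ν := by
        rw [regError, if_pos hj]
    _ ≤ eLpNorm ((∑ z, fun p => |f z p|) + R) 2 ν :=
        eLpNorm_mono_real fun p => by simpa using hpt p
    _ ≤ eLpNorm (∑ z, fun p => |f z p|) 2 ν + eLpNorm R 2 ν :=
        eLpNorm_add_le (Finset.aestronglyMeasurable_sum _ fun z _ =>
          (hfm z).abs.aestronglyMeasurable) hRm.aestronglyMeasurable one_le_two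
    _ ≤ ∑ z, eLpNorm (fun p => |f z p|) 2 ν + eLpNorm R 2 ν := by
        gcongr
        exact eLpNorm_sum_le (fun z _ => (hfm z).abs.aestronglyMeasurable) one_le_two
    -- The propagated error enters with factor `1`; it is enlarged to `|𝓛|` only in the last line.
    _ ≤ ∑ _z : 𝓛, (stochError 1488 W M (Ψ j) + ENNReal.ofReal (Real.sqrt 2) *
          ⨆ z : 𝓛, approxError m d W proj (Ψ j) j z) + 1 * regError m d W proj (j + 1) := by
        rw [one_mul]
        refine add_le_add (Finset.sum_le_sum fun z _ => ?_)
          (eLpNorm_iSup_condC_sub_le hH h hW0 hC hWC.ge hj)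
        have e : eLpNorm (fun p => |f z p|) 2 ν = eLpNorm (f z) 2 ν := eLpNorm_norm (f z)
        rw [e]
        refine (eLpNorm_proj_sub_condC_le hH h hW hM hCW hj hΨ z).trans ?_
        gcongr
        exact le_iSup (fun z : 𝓛 => approxError m d W proj (Ψ j) j z) z
    _ ≤ _ := by
        rw [Finset.sum_const, Finset.card_univ, nsmul_eq_mul]
        gcongr

end Propagation

end RegressionControl

theorem mainTheorem1 :
    ∃ c : ℝ, 0 < c ∧
      ∀ (Ω 𝒳 𝓚 𝓛 : Type*) [MeasurableSpace Ω] [MeasurableSpace 𝒳] [Fintype 𝓚] [Fintype 𝓛]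
        (m : RegressionControl.MarkovModel Ω 𝒳) (d : RegressionControl.ControlData 𝒳 𝓚 𝓛)
        (C_H W : ℝ) (M : ℕ) (Ψ : ℕ → Set (𝒳 → ℝ))
        (proj : ℕ → 𝓛 → RegressionControl.Sample 𝒳 m.J M → 𝒳 → ℝ),
        (∀ j ≤ m.J, ∀ a y x, |d.H j a y x| ≤ C_H) →
        W = m.J * C_H → 1 ≤ W → 1 ≤ M →
        (∀ j < m.J, ∀ w ∈ Ψ j, Measurable w) →
        RegressionControl.IsRegression d W Ψ proj →
        ∀ j < m.J,
          RegressionControl.regError m d W proj j ≤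
            (Fintype.card 𝓛 : ENNReal) *
              (RegressionControl.stochError c W M (Ψ j) +
                ENNReal.ofReal (Real.sqrt 2) *
                  ⨆ z : 𝓛, RegressionControl.approxError m d W proj (Ψ j) j z) +
            (Fintype.card 𝓛 : ENNReal) * RegressionControl.regError m d W proj (j + 1) := by
  refine ⟨1488, by norm_num, ?_⟩
  intro Ω 𝒳 𝓚 𝓛 _ _ _ _ m d C_H W M Ψ proj hH hWC hW hM hΨ h j hj
  exact RegressionControl.regError_le hH h hWC hW hM hj (hΨ j hj)
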